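/- **Conventions.** Let $\Sigma$ be a finite alphabet. A $\Sigma$-tree is a map $t\colon \operatorname{dom}(t)\to\Sigma$ on a finite, possibly empty, prefix-closed set $\operatorname{dom}(t)\subseteq\{0,1\}^*$. A (deterministic bottom-up) tree automaton over $\Sigma$ has a finite state set $Q$, a start state $\iota\in Q$, a transition function $\delta\colon\Sigma\times Q\times Q\to Q$ and a set $F\subseteq Q$ of accepting states; the empty tree evaluates to $\iota$, and a tree with root label $a$ whose left and right subtrees evaluate to $p$ and $q$ evaluates to $\delta(a,p,q)$. Its language $L(\mathcal A)$ is the set of trees that evaluate to a state in $F$. With a new symbol $\Box\notin\Sigma$, the convolution $\otimes(t_1,\dots,t_n)$ is the tree over $(\Sigma\cup\{\Box\})^n$ with domain $\bigcup_i\operatorname{dom}(t_i)$ whose label at $u$ has as $i$-th component $t_i(u)$ if $u\in\operatorname{dom}(t_i)$, and $\Box$ otherwise. An automaton recognises an $n$-ary relation $R$ on trees if its language is $\{\otimes\bar t\mid\bar t\in R\}$. A *tree-automatic presentation* of a linear ordering $(A;\le)$ is a pair $(\mathcal A,\mathcal A_\le)$ of tree automata, over $\Sigma$ and over $(\Sigma\cup\{\Box\})^2$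 respectively, for which there is a bijection $\mu\colon A\to L(\mathcal A)$ such that $\mathcal A_\le$ recognises $\{(\mu(x),\mu(y))\mid x\le y\}$. Let $T(\mathcal A)=\bigcup_{t\in L(\mathcal A)}\operatorname{dom}(t)\subseteq\{0,1\}^*$, ordered by the prefix relation $\preceq$. The presentation is *$T_{\mathrm{bin}}$-free* if there is no injection $f\colon\{0,1\}^*\to T(\mathcal A)$ with $u\preceq v\iff f(u)\preceq f(v)$ for all $u,v$. An infinite branch of a prefix-closed set $T\subseteq\{0,1\}^*$ is an infinite prefix-closed subset of $T$ that is linearly ordered by $\preceq$; the derivative $d(T)$ is the set of all $u\in T$ that lie on at least two distinct infinite branches of $T$. The *rank* of a $T_{\mathrm{bin}}$-free presentation is the $\operatorname{CB}_*$-rank of $T(\mathcal A)$, i.e. the least $n\in\mathbb N$ such that the $n$-fold derivative $d^{(n)}(T(\mathcal A))$ is finite. For a linear ordering $A$ define equivalence relations $\sim_\alpha$ on $A$ with interval classes, for all ordinals $\alpha$: $\sim_0$ is equality; $x\sim_{\beta+1}y$ iff the closed interval between the classes of $x$ and $y$ in the induced linear ordering $A/{\sim_\beta}$ is finite; and for limit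 $\alpha$, $x\sim_\alpha y$ iff $x\sim_\beta y$ for some $\beta<\alpha$. The *$\operatorname{FC}$-rank* $\operatorname{FC}(A)$ is the least ordinal $\alpha$ such that $\sim_\beta$ coincides with $\sim_\alpha$ for all $\beta\ge\alpha$. **Theorem.** Let $k\ge 1$ be a natural number and let $A$ be a linear ordering which admits a $T_{\mathrm{bin}}$-free tree-automatic presentation of rank $k$. Then $$\operatorname{FC}(A)<\omega^k .$$ -/

import Mathlib

namespace TreeAut

/-! ### Labelled trees

A tree over an alphabet `α`, i.e. a map `D → α` on a finite prefix-closed set `D` of words over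
`{0,1}` (`0 = false`, `1 = true`), is an element of Mathlib's `BinaryTree α`: `nil` is the
empty tree, and `node a l r` has label `a` at the root `[]`, `l` below the node `0` and `r` below
the node `1`. `label t` is the corresponding partial map; `label_injective` and `exists_label_iff`
say that this is a one-to-one correspondence. -/

/-- `label t u = some a` if `u` is a node of `t` with label `a`, and `none` if it is not a node. -/
def label {α : Type*} : BinaryTree α → List Bool → Option α
  | .nil, _ => none
  | .node a _ _, [] => some a
  | .node _ l _, false :: u => label l u
  | .node _ _ r, true :: u => label r u

/-- The domain of a tree. -/
def dom {α : Type*} (t : BinaryTree α) : Set (List Bool) := {u | label t u ≠ none}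

theorem label_injective {α : Type*} :
    Function.Injective (label : BinaryTree α → List Bool → Option α) := by
  intro s
  induction s with
  | nil =>
    intro t h
    cases t with
    | nil => rfl
    | node b l' r' => exact absurd (congrFun h []) (by simp [label])
  | node a l r ihl ihr =>
    intro t h
    cases t with
    | nil => exact absurd (congrFun h []) (by simp [label])
    | node b l' r' =>
      have h0 : a = b := by simpa [label] using congrFun h []
      have hl : l = l' := ihl (funext fun u => by simpa [label] using congrFun h (false :: u))
      have hr : r = r' := ihr (funext fun u => by simpa [label] using congrFun h (true :: u))
      rw [h0, hl, hr]

theorem exists_label_iff {α : Type*} (f : List Bool → Option α) :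
    (∃ t, label t = f) ↔
      {u | f u ≠ none}.Finite ∧ ∀ u v, u <+: v → f v ≠ none → f u ≠ none := by
  constructor
  · rintro ⟨t, rfl⟩
    induction t with
    | nil => simp [label]
    | node a l r ihl ihr =>
      constructor
      · refine (((Set.finite_singleton ([] : List Bool)).union (ihl.1.image (false :: ·))).union
          (ihr.1.image (true :: ·))).subset ?_
        rintro (_ | ⟨_ | _, u⟩) hu <;> simp_all [label]
      · rintro (_ | ⟨b, u⟩) v huv hv
        · simp [label]
        · obtain ⟨w, rfl⟩ := huv
          cases b
          · exact ihl.2 u (u ++ w) (List.prefix_append _ _) (by simpa [label] using hv)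
          · exact ihr.2 u (u ++ w) (List.prefix_append _ _) (by simpa [label] using hv)
  · rintro ⟨hfin, hpre⟩
    obtain ⟨n, hn⟩ : ∃ n, ∀ u, f u ≠ none → u.length < n := by
      obtain ⟨n, hn⟩ := (hfin.image List.length).bddAbove
      exact ⟨n + 1, fun u hu => Nat.lt_succ_of_le (hn ⟨u, hu, rfl⟩)⟩
    clear hfin
    induction n generalizing f with
    | zero =>
      refine ⟨.nil, funext fun u => ?_⟩
      by_contra h
      exact absurd (hn u (fun h' => h (by simp [label, h']))) (by simp)
    | succ n ih =>
      rcases h0 : f [] with _ | a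
      · refine ⟨.nil, funext fun u => ?_⟩
        by_contra h
        exact hpre [] u List.nil_prefix (fun h' => h (by simp [label, h'])) h0
      · have key : ∀ b : Bool, ∃ t, label t = fun u => f (b :: u) := fun b =>
          ih _ (fun u v huv hv => hpre (b :: u) (b :: v) (by simpa using huv) hv)
            (fun u hu => by simpa using hn (b :: u) hu)
        obtain ⟨l, hl⟩ := key false
        obtain ⟨r, hr⟩ := key true
        refine ⟨.node a l r, funext fun u => ?_⟩
        rcases u with _ | ⟨_ | _, u⟩
        · simp [label, h0]
        · simpa [label] using congrFun hl u
        · simpa [label] using congrFun hr u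

/-- The convolution of a tuple of trees: its domain is the union of the domains, and a node `u`
carries the tuple of labels of `u`, where `none` plays the role of the padding symbol
(see `label_convolution`). -/
noncomputable def convolution {α : Type*} {n : ℕ} (t : Fin n → BinaryTree α) :
    BinaryTree (Fin n → Option α) :=
  open Classical in
  if h : ∀ i, t i = .nil then .nil
  else .node (fun i => label (t i) [])
    (convolution fun i => (t i).left) (convolution fun i => (t i).right)
termination_by ∑ i, (t i).numNodes
decreasing_by
  all_goals
    obtain ⟨i, hi⟩ := not_forall.1 h
    refine Finset.sum_lt_sum (fun j _ => ?_) ⟨i, Finset.mem_univ _, ?_⟩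
    · rcases t j with _ | ⟨a, l, r⟩ <;> simp only [BinaryTree.left, BinaryTree.right,
        BinaryTree.numNodes] <;> omega
    · rcases h' : t i with _ | ⟨a, l, r⟩
      · exact absurd h' hi
      · simp only [BinaryTree.left, BinaryTree.right, BinaryTree.numNodes]
        omega

open Classical in
theorem label_convolution {α : Type*} {n : ℕ} (t : Fin n → BinaryTree α) (u : List Bool) :
    label (convolution t) u =
      if ∀ i, label (t i) u = none then none else some fun i => label (t i) u := by
  induction u generalizing t with
  | nil =>
    rw [convolution]
    have : ∀ i, label (t i) [] = none ↔ t i = .nil := fun i => by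
      rcases t i with _ | ⟨a, l, r⟩ <;> simp [label]
    simp only [this]
    split_ifs <;> simp [label]
  | cons b u ih =>
    rw [convolution]
    have hf : ∀ i, label (t i).left u = label (t i) (false :: u) := fun i => by
      rcases t i with _ | ⟨a, l, r⟩ <;> simp [label, BinaryTree.left]
    have ht : ∀ i, label (t i).right u = label (t i) (true :: u) := fun i => by
      rcases t i with _ | ⟨a, l, r⟩ <;> simp [label, BinaryTree.right]
    split_ifs with h h' h'
    · simp [label]
    · exact absurd (fun i => by simp [h i, label]) h'
    · cases b <;> simp only [label, ih, hf, ht, if_pos h']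
    · cases b <;> simp only [label, ih, hf, ht, if_neg h']

/-! ### Tree automata and tree-automatic presentations -/

/-- Deterministic bottom-up tree automata over the alphabet `α`. -/
structure TreeAutomaton (α : Type*) where
  State : Type
  finite_state : Finite State
  start : State
  step : α → State → State → State
  accept : Set State

/-- The state reached at the root of a tree; missing children contribute the start state. -/
def TreeAutomaton.run {α : Type*} (𝒜 : TreeAutomaton α) : BinaryTree α → 𝒜.State
  | .nil => 𝒜.start
  | .node a l r => 𝒜.step a (𝒜.run l) (𝒜.run r)

/-- The tree language recognised by an automaton. -/
def TreeAutomaton.language {α : Type*} (𝒜 : TreeAutomaton α) : Set (BinaryTree α) :=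
  {t | 𝒜.run t ∈ 𝒜.accept}

/-- An automaton over the alphabet of `n`-tuples with padding recognises the `n`-ary relation `X`
if its language is the set of convolutions of the tuples in `X`. -/
def TreeAutomaton.Recognises {α : Type*} {n : ℕ} (𝒜 : TreeAutomaton (Fin n → Option α))
    (X : Set (Fin n → BinaryTree α)) : Prop :=
  𝒜.language = convolution '' X

/-- The tuples of automata that are candidates for tree-automatic presentations of structures over
the signature `L`: one automaton for the universe, one for each relation symbol. -/
structure Presentation (α : Type*) (L : FirstOrder.Language) where
  univ : TreeAutomaton α
  rel : ∀ {n : ℕ}, L.Relations n → TreeAutomaton (Fin n → Option α)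

/-- `P` is a tree-automatic presentation of the relational structure `M`: there is a bijective
naming function `μ` from `M` onto the language of `P.univ` such that `P.rel R` recognises the image
of `R` under `μ`, for every relation symbol `R`. -/
def Presentation.Presents {α : Type*} {L : FirstOrder.Language} [L.IsRelational]
    [Finite L.Symbols] (P : Presentation α L) (M : Type*) [L.Structure M] : Prop :=
  ∃ μ : M → BinaryTree α, Set.BijOn μ Set.univ P.univ.language ∧
    ∀ (n : ℕ) (R : L.Relations n),
      (P.rel R).Recognises ((fun x : Fin n → M => μ ∘ x) '' {x | FirstOrder.Language.Structure.RelMap R x})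

/-! ### Branching complexity

Binary trees are prefix-closed sets of words over `{0,1}`. -/

/-- The binary tree `T(L)` of a tree language `L`: the union of the domains. -/
def domainTree {α : Type*} (K : Set (BinaryTree α)) : Set (List Bool) := ⋃ t ∈ K, dom t

/-- The infinite full binary tree does not embed into `T`. -/
def TbinFree (T : Set (List Bool)) : Prop :=
  ¬ ∃ f : List Bool → List Bool,
    Function.Injective f ∧ (∀ u, f u ∈ T) ∧ ∀ u v, u <+: v ↔ f u <+: f v

/-- `P` is an infinite branch of `T`. -/
def IsInfiniteBranch (T P : Set (List Bool)) : Prop :=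
  P ⊆ T ∧ P.Infinite ∧ (∀ u v, u <+: v → v ∈ P → u ∈ P) ∧
    ∀ u ∈ P, ∀ v ∈ P, u <+: v ∨ v <+: u

/-- The derivative of `T`: the nodes on at least two distinct infinite branches. -/
def derivative (T : Set (List Bool)) : Set (List Bool) :=
  {u | u ∈ T ∧ ∃ P Q, IsInfiniteBranch T P ∧ IsInfiniteBranch T Q ∧ P ≠ Q ∧ u ∈ P ∧ u ∈ Q}

/-- The `CB_*`-rank of `T` is `k`: `k` is least such that the `k`-th derivative is finite. -/
def HasCBRank (T : Set (List Bool)) (k : ℕ) : Prop :=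
  IsLeast {n : ℕ | (derivative^[n] T).Finite} k

/-- A presentation is `T_bin`-free if its binary tree of domains is. -/
def Presentation.TbinFree {α : Type*} {L : FirstOrder.Language} (P : Presentation α L) : Prop :=
  TreeAut.TbinFree (domainTree P.univ.language)

/-- The rank of a presentation is the `CB_*`-rank of its binary tree of domains. -/
def Presentation.HasRank {α : Type*} {L : FirstOrder.Language} (P : Presentation α L) (k : ℕ) :
    Prop :=
  HasCBRank (domainTree P.univ.language) k

/-! ### The `FC`-rank of a linear ordering -/

section FC

universe u
variable {A : Type u} [LinearOrder A]

/-- A condensation: an equivalence relation whose classes are intervals. -/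
def IsCondensation (r : A → A → Prop) : Prop :=
  Equivalence r ∧ ∀ x, {y | r x y}.OrdConnected

/-- The order on the classes of a condensation: `X = Y`, or every element of `X` is strictly below
every element of `Y`. -/
def ClassLE (X Y : Set A) : Prop := X = Y ∨ ∀ x ∈ X, ∀ y ∈ Y, x < y

/-- The closed interval between the classes of `x` and `y` in the quotient of `A` by `r`; an
element of the quotient is a class `{w | r z w}`. As for closed intervals in `A`, the two end
points may be given in either order. -/
def classInterval (r : A → A → Prop) (x y : A) : Set (Set A) :=
  {c | (∃ z, c = {w | r z w}) ∧
    ((ClassLE {w | r x w} c ∧ ClassLE c {w | r y w}) ∨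
      (ClassLE {w | r y w} c ∧ ClassLE c {w | r x w}))}

/-- The iterated finite condensations: equality at `0`; at `β + 1`, the interval between the two
classes in the quotient by the `β`-th condensation is finite; the union at limits. -/
noncomputable def fcRel (A : Type u) [LinearOrder A] (α : Ordinal.{u}) : A → A → Prop :=
  Ordinal.limitRecOn α (fun x y => x = y)
    (fun _ r x y => (classInterval r x y).Finite)
    (fun α _ ih x y => ∃ β, ∃ h : β < α, ih β h x y)

/-- The `FC`-rank: the least `α` from which on the iterated finite condensations coincide. -/
noncomputable def fcRank (A : Type u) [LinearOrder A] : Ordinal.{u} :=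
  sInf {α : Ordinal.{u} | ∀ β, α ≤ β → fcRel A β = fcRel A α}

theorem fcRel_zero : fcRel A 0 = fun x y => x = y := by
  rw [fcRel, Ordinal.limitRecOn_zero]

theorem fcRel_add_one (α : Ordinal.{u}) :
    fcRel A (α + 1) = fun x y => (classInterval (fcRel A α) x y).Finite := by
  rw [fcRel, Ordinal.limitRecOn_add_one]; rfl

theorem fcRel_limit (α : Ordinal.{u}) (h : Order.IsSuccLimit α) :
    fcRel A α = fun x y => ∃ β, β < α ∧ fcRel A β x y := by
  rw [fcRel, Ordinal.limitRecOn_limit _ _ _ _ h]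
  simp only [exists_prop]; rfl

theorem IsCondensation.classLE_iff {r : A → A → Prop} (hr : IsCondensation r) (x y : A) :
    ClassLE {w | r x w} {w | r y w} ↔ x ≤ y ∨ r x y := by
  constructor
  · rintro (h | h)
    · right
      have hy : y ∈ {w | r y w} := hr.1.refl y
      rw [← h] at hy
      exact hy
    · exact .inl (h x (hr.1.refl x) y (hr.1.refl y)).le
  · intro h
    by_cases hxy : r x y
    · left
      ext w
      exact ⟨fun hw => hr.1.trans (hr.1.symm hxy) hw, fun hw => hr.1.trans hxy hw⟩
    · right
      have hlt : x ≤ y := h.resolve_right hxy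
      intro a ha b hb
      by_contra hab
      have hab : b ≤ a := not_lt.1 hab
      apply hxy
      rcases le_total b x with hbx | hxb
      · exact hr.1.trans ((hr.2 b).out (hr.1.refl b) (hr.1.symm hb) ⟨hbx, hlt⟩ |> hr.1.symm)
          (hr.1.symm hb)
      · exact hr.1.trans ((hr.2 x).out (hr.1.refl x) ha ⟨hxb, hab⟩) (hr.1.symm hb)

theorem IsCondensation.next {r : A → A → Prop} (hr : IsCondensation r) :
    IsCondensation (fun x y => (classInterval r x y).Finite) ∧
      ∀ x y, r x y → (classInterval r x y).Finite := by
  have hsymm : ∀ x y, classInterval r x y = classInterval r y x := fun x y => by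
    ext c; simp only [classInterval, Set.mem_ofPred_eq]; tauto
  have htr : ∀ x y z, (x ≤ y ∨ r x y) → (y ≤ z ∨ r y z) → (x ≤ z ∨ r x z) := by
    intro x y z h h'
    rw [← hr.classLE_iff] at h h' ⊢
    rcases h with h | h
    · rwa [h]
    · rcases h' with h' | h'
      · rw [← h']; exact .inr h
      · exact .inr fun a ha b hb => (h a ha y (hr.1.refl y)).trans (h' y (hr.1.refl y) b hb)
  have hsub : ∀ x y z, classInterval r x z ⊆ classInterval r x y ∪ classInterval r y z := by
    rintro x y z c ⟨⟨w, rfl⟩, h⟩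
    simp only [hr.classLE_iff] at h
    have htot : (w ≤ y ∨ r w y) ∨ (y ≤ w ∨ r y w) :=
      (le_total w y).imp Or.inl Or.inl
    rcases h with ⟨h1, h2⟩ | ⟨h1, h2⟩ <;> rcases htot with h3 | h3
    · exact .inl ⟨⟨w, rfl⟩, by simpa only [hr.classLE_iff] using .inl ⟨h1, h3⟩⟩
    · exact .inr ⟨⟨w, rfl⟩, by simpa only [hr.classLE_iff] using .inl ⟨h3, h2⟩⟩
    · exact .inr ⟨⟨w, rfl⟩, by simpa only [hr.classLE_iff] using .inr ⟨h1, h3⟩⟩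
    · exact .inl ⟨⟨w, rfl⟩, by simpa only [hr.classLE_iff] using .inr ⟨h3, h2⟩⟩
  have hmono : ∀ x y, r x y → (classInterval r x y).Finite := by
    intro x y hxy
    refine (Set.finite_singleton {w | r x w}).subset ?_
    rintro c ⟨⟨w, rfl⟩, h⟩
    simp only [hr.classLE_iff] at h
    have hxw : r x w := by
      by_contra hn
      have hn' : ¬ r w x := fun h => hn (hr.1.symm h)
      have hn1 : ¬ r w y := fun h => hn' (hr.1.trans h (hr.1.symm hxy))
      have hn2 : ¬ r y w := fun h => hn1 (hr.1.symm h)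
      simp only [hn, hn', hn1, hn2, or_false] at h
      rcases h with h | h
      · exact hn ((hr.2 x).out (hr.1.refl x) hxy h)
      · exact hn ((hr.2 x).out hxy (hr.1.refl x) h)
    ext v
    exact ⟨fun hv => hr.1.trans hxw hv, fun hv => hr.1.trans (hr.1.symm hxw) hv⟩
  have heq : Equivalence fun x y => (classInterval r x y).Finite :=
    ⟨fun x => hmono x x (hr.1.refl x), fun {x y} h => hsymm x y ▸ h,
      fun {x y z} h h' => (h.union h').subset (hsub x y z)⟩
  have hstep : ∀ a b z : A, a ≤ z → z ≤ b → (classInterval r a b).Finite →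
      (classInterval r a z).Finite := by
    intro a b z haz hzb h
    by_cases hrz : r a z
    · exact hmono a z hrz
    · refine h.subset ?_
      rintro c ⟨⟨w, rfl⟩, h⟩
      simp only [hr.classLE_iff] at h
      rcases h with ⟨h1, h2⟩ | ⟨h1, h2⟩
      · refine ⟨⟨w, rfl⟩, ?_⟩
        simp only [hr.classLE_iff]
        exact .inl ⟨h1, htr w z b h2 (.inl hzb)⟩
      · rcases htr z w a h1 h2 with h | h
        · exact absurd ((le_antisymm haz h) ▸ hr.1.refl a) hrz
        · exact absurd (hr.1.symm h) hrz
  refine ⟨⟨heq, fun x => ⟨?_⟩⟩, hmono⟩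
  intro a ha b hb z hz
  exact heq.trans ha (hstep a b z hz.1 hz.2 (heq.trans (heq.symm ha) hb))

/-- The relations `fcRel A α` are condensations and increase with `α`. -/
theorem fcRel_spec (β : Ordinal.{u}) :
    IsCondensation (fcRel A β) ∧ ∀ α ≤ β, ∀ x y, fcRel A α x y → fcRel A β x y := by
  induction β using Ordinal.limitRecOn with
  | zero =>
    refine ⟨?_, fun α hα x y h => ?_⟩
    · rw [fcRel_zero]
      refine ⟨⟨fun _ => rfl, fun h => h.symm, fun h h' => h.trans h'⟩, fun x => ?_⟩
      have : {y | x = y} = {x} := by ext; simp [eq_comm]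
      rw [this]
      exact Set.ordConnected_singleton
    · rwa [le_antisymm hα (zero_le)] at h
  | add_one β ih =>
    have := ih.1.next
    rw [fcRel_add_one]
    refine ⟨this.1, fun α hα x y h => ?_⟩
    rcases hα.lt_or_eq with hα | rfl
    · exact this.2 x y (ih.2 α (Order.lt_add_one_iff.1 hα) x y h)
    · rwa [fcRel_add_one] at h
  | limit β hβ ih =>
    rw [fcRel_limit β hβ]
    refine ⟨⟨⟨fun x => ⟨0, hβ.bot_lt, (ih 0 hβ.bot_lt).1.1.refl x⟩, ?_, ?_⟩, fun x => ⟨?_⟩⟩, ?_⟩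
    · rintro x y ⟨γ, hγ, h⟩
      exact ⟨γ, hγ, (ih γ hγ).1.1.symm h⟩
    · rintro x y z ⟨γ, hγ, h⟩ ⟨δ, hδ, h'⟩
      have hm : max γ δ < β := max_lt hγ hδ
      exact ⟨max γ δ, hm, (ih _ hm).1.1.trans ((ih _ hm).2 γ (le_max_left _ _) _ _ h)
        ((ih _ hm).2 δ (le_max_right _ _) _ _ h')⟩
    · rintro a ⟨γ, hγ, h⟩ b ⟨δ, hδ, h'⟩ z hz
      have hm : max γ δ < β := max_lt hγ hδ
      exact ⟨max γ δ, hm, ((ih _ hm).1.2 x).out ((ih _ hm).2 γ (le_max_left _ _) _ _ h)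
        ((ih _ hm).2 δ (le_max_right _ _) _ _ h') hz⟩
    · intro α hα x y h
      rcases hα.lt_or_eq with hα | rfl
      · exact ⟨α, hα, h⟩
      · rwa [fcRel_limit _ hβ] at h

/-- The set of ordinals in the definition of `fcRank` is never empty. -/
theorem fcRank_mem (A : Type u) [LinearOrder A] :
    fcRank A ∈ {α : Ordinal.{u} | ∀ β, α ≤ β → fcRel A β = fcRel A α} := by
  apply csInf_mem
  let g : A × A → Ordinal.{u} := fun p => sInf {α | fcRel A α p.1 p.2}
  obtain ⟨γ, hγ⟩ := Ordinal.bddAbove_of_small (s := Set.range g)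
  refine ⟨γ, fun β hβ => ?_⟩
  ext x y
  refine ⟨fun h => ?_, (fcRel_spec β).2 γ hβ x y⟩
  have hm : fcRel A (g (x, y)) x y := csInf_mem (s := {α | fcRel A α x y}) ⟨β, h⟩
  exact (fcRel_spec γ).2 _ (hγ ⟨(x, y), rfl⟩) x y hm

end FC

end TreeAut

/-!
The proof replaces the iterated condensations by a notion of dimension that behaves well under
decompositions. A set of dimension at most `α` is covered by finitely many pieces such that, inside
each piece, the part between any two points has dimension less than `α` (`DimLE`). A subset has at
most the dimension of the whole, and a finite union has at most the maximum of the dimensions of its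
parts. On intervals, dimension and condensations agree up to one: if `x` and `y` are identified by
the `α`-th condensation, then `[x, y]` has dimension at most `α` (`dimLE_Icc_of_fcRel`), and
conversely dimension at most `α` implies that they are identified by the `(α + 1)`-st
(`fcRel_add_one_of_dimLE`). In particular, if no interval has a dimension in `[δ, Λ)` for some
`Λ > δ + 1`, then the condensations are constant from `δ` on (`fcRel_eq_of_dimLE_gap`). It thus
suffices to find such a gap with `δ = ω ^ k * M` and `Λ = ω ^ (k + 1)`, for a presentation of rank
at most `k + 1`.

Let `x` and `y` be trees. The trees `t` are sorted into finitely many cells, according to the states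
reached on `t`, `(x, t)`, `(t, y)`, `(t, t)`, `(∅, t)` and `(t, ∅)`. The interval `[x, y]` is a
union of such cells. Cutting trees at the root, a cell is a finite union of boxes, whose sides are
cells for the subtrees of `x` and `y`; the order on a box extends the componentwise order, and it is
determined by the states reached on the pairs of components. Because of this finite colouring, the
dimension of a box is at most the natural sum of the dimensions of its sides (`IsBox.dimLE`).
Cutting further until `x` and `y` are used up, one arrives at cells for the empty trees, of which
there are only finitely many, independently of `x` and `y`. They are also subsets of the interval up
to isomorphism, so if the interval has dimension less than `ω ^ (k + 1)`, so do they; being finitely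
many, they have dimensions below a common `ω ^ k * J`, which does not depend on `x` and `y`.

The number of sides is not bounded, but the branching complexity controls the sum. Below a node
outside the `(k + 1)`-st derivative, which is finite, at least one of the two children has a subtree
whose `k`-th derivative is finite, and by induction on `k` the side belonging to this child has
dimension less than `ω ^ k`. As natural sums of ordinals less than `ω ^ k` stay below `ω ^ k`, only
the nodes in the `(k + 1)`-st derivative increase the multiple of `ω ^ k`, each of them by a factor
of at most two. This gives the bound `ω ^ k * (J * 2 ^ N)`, where `N` is the number of these nodes
(`LeafBound.exists_dimLE_lt_mul`). The induction on `k` is `leafBound`; it again uses the gap, now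
for the orders on cells.
-/

namespace TreeAut

/-! ### Condensation dimension of subsets of a relation -/

section DimLE

universe v w
variable {X : Type v}

/-- `DimLE r α s`: the set `s`, ordered by `r`, has condensation dimension at most `α`. That is,
`s` is covered by finitely many sets `e` such that for any two distinct points `x, y ∈ e` the part
of `e` between `x` and `y` has dimension less than `α`. Dimension at most `0` means finite. Unlike
the relations `fcRel`, the notion is invariant under passing to subsets and under finite unions
by construction. -/
def DimLE (r : X → X → Prop) (α : Ordinal.{w}) (s : Set X) : Prop :=
  ∃ E : Set (Set X), E.Finite ∧ s ⊆ ⋃₀ E ∧ ∀ e ∈ E, ∀ x ∈ e, ∀ y ∈ e, x ≠ y →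
    ∃ β, ∃ _ : β < α, DimLE r β {z | z ∈ e ∧ r x z ∧ r z y}
termination_by α

theorem dimLE_iff {r : X → X → Prop} {α : Ordinal.{w}} {s : Set X} :
    DimLE r α s ↔ ∃ E : Set (Set X), E.Finite ∧ s ⊆ ⋃₀ E ∧ ∀ e ∈ E, ∀ x ∈ e, ∀ y ∈ e, x ≠ y →
      ∃ β < α, DimLE r β {z | z ∈ e ∧ r x z ∧ r z y} := by
  rw [DimLE]
  simp only [exists_prop]

theorem DimLE.mono_rank {r : X → X → Prop} {α β : Ordinal.{w}} {s : Set X} (h : DimLE r α s)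
    (hαβ : α ≤ β) : DimLE r β s := by
  rw [dimLE_iff] at h ⊢
  obtain ⟨E, hE, hs, h⟩ := h
  refine ⟨E, hE, hs, fun e he x hx y hy hxy => ?_⟩
  obtain ⟨γ, hγ, h'⟩ := h e he x hx y hy hxy
  exact ⟨γ, hγ.trans_le hαβ, h'⟩

/-- The dimension does not increase under pulling back along an order embedding. -/
theorem DimLE.comap {Y : Type*} {r : X → X → Prop} {r' : Y → Y → Prop} {α : Ordinal.{w}}
    {s : Set X} {t : Set Y} (h : DimLE r' α t) (f : X → Y) (hf : Set.InjOn f s)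
    (hst : Set.MapsTo f s t) (hr : ∀ x ∈ s, ∀ y ∈ s, r x y → r' (f x) (f y)) :
    DimLE r α s := by
  induction α using WellFoundedLT.induction generalizing s t with
  | ind α ih =>
    rw [dimLE_iff] at h ⊢
    obtain ⟨E, hE, hs, h⟩ := h
    refine ⟨(fun e => s ∩ f ⁻¹' e) '' E, hE.image _, fun x hx => ?_, ?_⟩
    · obtain ⟨e, he, hxe⟩ := hs (hst hx)
      exact ⟨_, ⟨e, he, rfl⟩, hx, hxe⟩
    · rintro _ ⟨e, he, rfl⟩ x hx y hy hxy
      obtain ⟨β, hβ, h'⟩ := h e he (f x) hx.2 (f y) hy.2 fun h => hxy (hf hx.1 hy.1 h)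
      refine ⟨β, hβ, ih β hβ h' (hf.mono fun z hz => hz.1.1) ?_ ?_⟩
      · exact fun z hz => ⟨hz.1.2, hr _ hx.1 _ hz.1.1 hz.2.1, hr _ hz.1.1 _ hy.1 hz.2.2⟩
      · exact fun z hz z' hz' => hr z hz.1.1 z' hz'.1.1

theorem DimLE.mono {r : X → X → Prop} {α : Ordinal.{w}} {s t : Set X} (h : DimLE r α t)
    (hst : s ⊆ t) : DimLE r α s :=
  h.comap id (Set.injOn_id _) hst fun _ _ _ _ => id

theorem dimLE_of_finite {r : X → X → Prop} {s : Set X} (hs : s.Finite) (α : Ordinal.{w}) :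
    DimLE r α s := by
  rw [dimLE_iff]
  refine ⟨(fun x => {x}) '' s, hs.image _, fun x hx => ⟨{x}, ⟨x, hx, rfl⟩, rfl⟩, ?_⟩
  rintro _ ⟨x, -, rfl⟩ y rfl z rfl h
  exact absurd rfl h

theorem DimLE.union {r : X → X → Prop} {α : Ordinal.{w}} {s t : Set X} (hs : DimLE r α s)
    (ht : DimLE r α t) : DimLE r α (s ∪ t) := by
  rw [dimLE_iff] at hs ht ⊢
  obtain ⟨E, hE, hs, h⟩ := hs
  obtain ⟨F, hF, ht, h'⟩ := ht
  refine ⟨E ∪ F, hE.union hF, ?_, ?_⟩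
  · rw [Set.sUnion_union]
    exact Set.union_subset_union hs ht
  · rintro e (he | he)
    · exact h e he
    · exact h' e he

theorem DimLE.biUnion {ι : Type*} {r : X → X → Prop} {α : Ordinal.{w}} {I : Set ι}
    (hI : I.Finite) {s : ι → Set X} (h : ∀ i ∈ I, DimLE r α (s i)) :
    DimLE r α (⋃ i ∈ I, s i) := by
  induction I, hI using Set.Finite.induction_on with
  | empty => simpa using dimLE_of_finite Set.finite_empty α
  | insert _ _ ih =>
    rw [Set.biUnion_insert]
    exact (h _ (Set.mem_insert _ _)).union (ih fun i hi => h i (Set.mem_insert_of_mem _ hi))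

/-- A finite union of sets of dimension less than `δ` has dimension less than `δ`. -/
theorem exists_dimLE_of_subset_iUnion {ι : Type*} [Finite ι] {r : X → X → Prop}
    {δ : Ordinal.{w}} (hδ : 0 < δ) {s : ι → Set X} {t : Set X} (hst : t ⊆ ⋃ i, s i)
    (h : ∀ i, ∃ γ < δ, DimLE r γ (s i)) : ∃ γ < δ, DimLE r γ t := by
  choose γ hγ h using h
  obtain ⟨c, hc, hγc⟩ : ∃ c < δ, ∀ i, γ i ≤ c := by
    cases nonempty_fintype ι
    refine ⟨Finset.univ.sup γ, (Finset.sup_lt_iff hδ).2 fun i _ => hγ i,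
      fun i => Finset.le_sup (Finset.mem_univ i)⟩
  refine ⟨c, hc, (DimLE.biUnion Set.finite_univ fun i _ => (h i).mono_rank (hγc i)).mono ?_⟩
  simpa using hst

/-- The dimension does not change when the order is reversed. -/
theorem DimLE.flip {r : X → X → Prop} {α : Ordinal.{w}} {s : Set X} (h : DimLE r α s) :
    DimLE (flip r) α s := by
  induction α using WellFoundedLT.induction generalizing s with
  | ind α ih =>
    rw [dimLE_iff] at h ⊢
    obtain ⟨E, hE, hs, h⟩ := h
    refine ⟨E, hE, hs, fun e he x hx y hy hxy => ?_⟩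
    obtain ⟨β, hβ, h'⟩ := h e he y hy x hx hxy.symm
    refine ⟨β, hβ, (ih β hβ h').mono fun z hz => ⟨hz.1, hz.2.2, hz.2.1⟩⟩

end DimLE

/-! ### Comparison with the finite condensations -/

section Condensation

universe u
variable {A : Type u} [LinearOrder A]

theorem classInterval_subset_of_le {r : A → A → Prop} (hr : IsCondensation r) {x y : A}
    (hxy : x ≤ y) : classInterval r x y ⊆ (fun z => {w | r z w}) '' Set.Icc x y := by
  rintro c ⟨⟨z, rfl⟩, h⟩
  simp only [hr.classLE_iff] at h
  have hcls : ∀ {a b}, r a b → {w | r a w} = {w | r b w} := fun h => Set.ext fun w =>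
    ⟨fun hw => hr.1.trans (hr.1.symm h) hw, fun hw => hr.1.trans h hw⟩
  have hx : r x z → {w | r z w} ∈ (fun z => {w | r z w}) '' Set.Icc x y := fun h =>
    ⟨x, ⟨le_rfl, hxy⟩, hcls h⟩
  have hy : r y z → {w | r z w} ∈ (fun z => {w | r z w}) '' Set.Icc x y := fun h =>
    ⟨y, ⟨hxy, le_rfl⟩, hcls h⟩
  rcases h with ⟨h1 | h1, h2 | h2⟩ | ⟨h1 | h1, h2 | h2⟩
  · exact ⟨z, ⟨h1, h2⟩, rfl⟩
  · exact hy (hr.1.symm h2)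
  · exact hx h1
  · exact hx h1
  · exact ⟨z, ⟨hxy.trans h1, h2.trans hxy⟩, rfl⟩
  · exact hx (hr.1.symm h2)
  · exact hy h1
  · exact hy h1

theorem image_Icc_subset_classInterval {r : A → A → Prop} (hr : IsCondensation r) {x y : A} :
    (fun z => {w | r z w}) '' Set.Icc x y ⊆ classInterval r x y := by
  rintro _ ⟨z, hz, rfl⟩
  refine ⟨⟨z, rfl⟩, ?_⟩
  simp only [hr.classLE_iff]
  exact .inl ⟨.inl hz.1, .inl hz.2⟩

/-- An interval whose end points are identified by the `α`-th condensation has dimension at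
most `α`. -/
theorem dimLE_Icc_of_fcRel {α : Ordinal.{u}} {x y : A} (h : fcRel A α x y) :
    DimLE (· ≤ ·) α (Set.Icc x y) := by
  induction α using Ordinal.limitRecOn generalizing x y with
  | zero =>
    rw [fcRel_zero] at h
    subst h
    exact dimLE_of_finite (Set.Icc_self x ▸ Set.finite_singleton x) _
  | add_one β ih =>
    have hc := (fcRel_spec (A := A) β).1
    rw [fcRel_add_one] at h
    rw [dimLE_iff]
    refine ⟨_, h, fun z hz => ?_, ?_⟩
    · exact ⟨_, image_Icc_subset_classInterval hc ⟨z, hz, rfl⟩, hc.1.refl z⟩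
    · rintro _ ⟨⟨z, rfl⟩, -⟩ a ha b hb -
      exact ⟨β, Order.lt_add_one_iff.2 le_rfl,
        (ih (hc.1.trans (hc.1.symm ha) hb)).mono fun w hw => hw.2⟩
  | limit α hα ih =>
    rw [fcRel_limit α hα] at h
    obtain ⟨β, hβ, h⟩ := h
    exact (ih β hβ h).mono_rank hβ.le

/-- A converse to `dimLE_Icc_of_fcRel`: an interval of dimension at most `α` meets only finitely
many classes of the `α`-th condensation. -/
theorem fcRel_add_one_of_dimLE {α : Ordinal.{u}} {x y : A} (hxy : x ≤ y)
    (h : DimLE (· ≤ ·) α (Set.Icc x y)) : fcRel A (α + 1) x y := by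
  induction α using WellFoundedLT.induction generalizing x y with
  | ind α ih =>
    have hc := (fcRel_spec (A := A) α).1
    rw [fcRel_add_one]
    refine Set.Finite.subset ?_ (classInterval_subset_of_le hc hxy)
    rw [dimLE_iff] at h
    obtain ⟨E, hE, hs, h⟩ := h
    by_contra hinf
    -- Representatives of more than `2 * |E|` distinct classes, in increasing order.
    obtain ⟨C, hC, hCcard⟩ := Set.Infinite.exists_subset_card_eq hinf (2 * hE.toFinset.card + 2)
    have hC' : ∀ c ∈ C, ∃ z ∈ Set.Icc x y, {w | fcRel A α z w} = c := fun c hcC => hC hcC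
    have : Nonempty A := ⟨x⟩
    choose! g hg hg' using hC'
    have hginj : Set.InjOn g C := fun c hc' d hd hcd => by
      rw [← hg' c hc', ← hg' d hd, hcd]
    classical
    let D := C.image g
    have hDcard : D.card = 2 * hE.toFinset.card + 2 := by
      rw [Finset.card_image_of_injOn hginj, hCcard]
    let p := D.orderEmbOfFin hDcard
    have hpD : ∀ i, p i ∈ D := D.orderEmbOfFin_mem hDcard
    have hpI : ∀ i, p i ∈ Set.Icc x y := fun i => by
      obtain ⟨c, hc', hc2⟩ := Finset.mem_image.1 (hpD i)
      exact hc2 ▸ hg c hc'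
    have hpne : ∀ i j, i ≠ j → ¬ fcRel A α (p i) (p j) := fun i j hij hr => by
      obtain ⟨c, hc', hc2⟩ := Finset.mem_image.1 (hpD i)
      obtain ⟨d, hd, hd2⟩ := Finset.mem_image.1 (hpD j)
      apply hij
      apply p.injective
      rw [← hc2, ← hd2] at hr ⊢
      congr 1
      rw [← hg' c hc', ← hg' d hd]
      exact Set.ext fun w => ⟨fun hw => hc.1.trans (hc.1.symm hr) hw, fun hw => hc.1.trans hr hw⟩
    -- No interval between consecutive representatives has dimension less than `α`, so some piece of
    -- the cover has dimension at least `α` there. For `α = 0` it is only relevant that the piece has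
    -- a point there.
    have key : ∀ i : Fin (2 * hE.toFinset.card + 1), ∃ e : hE.toFinset,
        ((e : Set A) ∩ Set.Icc (p i.castSucc) (p i.succ)).Nonempty ∧
        ∀ β < α, ¬ DimLE (· ≤ ·) β ((e : Set A) ∩ Set.Icc (p i.castSucc) (p i.succ)) := by
      intro i
      by_contra! hcon
      have hlt : p i.castSucc < p i.succ := p.strictMono Fin.castSucc_lt_succ
      have hα : 0 < α := by
        by_contra h0
        obtain ⟨e, he, hxe⟩ := hs (hpI i.castSucc)
        obtain ⟨β, hβ, -⟩ := hcon ⟨e, by simpa using he⟩ ⟨_, hxe, le_rfl, hlt.le⟩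
        exact h0 (bot_lt_of_lt hβ)
      have hcon' : ∀ e : hE.toFinset, ∃ β < α,
          DimLE (· ≤ ·) β ((e : Set A) ∩ Set.Icc (p i.castSucc) (p i.succ)) := fun e => by
        by_cases h0 : ((e : Set A) ∩ Set.Icc (p i.castSucc) (p i.succ)).Nonempty
        · exact hcon e h0
        · exact ⟨0, hα, dimLE_of_finite (Set.not_nonempty_iff_eq_empty.1 h0 ▸ Set.finite_empty) _⟩
      obtain ⟨β, hβ, hd⟩ := exists_dimLE_of_subset_iUnion (r := (· ≤ ·)) hα
        (t := Set.Icc (p i.castSucc) (p i.succ)) (s := fun e : hE.toFinset =>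
          (e : Set A) ∩ Set.Icc (p i.castSucc) (p i.succ)) (fun z hz => by
            obtain ⟨e, he, hze⟩ := hs ⟨(hpI _).1.trans hz.1, hz.2.trans (hpI _).2⟩
            exact Set.mem_iUnion.2 ⟨⟨e, by simpa using he⟩, hze, hz⟩) hcon'
      refine hpne _ _ (Fin.castSucc_lt_succ (i := i)).ne ?_
      exact (fcRel_spec α).2 _ (Order.add_one_le_of_lt hβ) _ _ (ih β hβ hlt.le hd)
    choose e he using key
    -- Some piece is large on three of these intervals, hence between two of its own points.
    obtain ⟨e₀, he₀⟩ := Fintype.exists_lt_card_fiber_of_mul_lt_card e (n := 2) (by simp; omega)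
    obtain ⟨i, j, k, hi, hj, hk, hij, hjk⟩ : ∃ i j k, e i = e₀ ∧ e j = e₀ ∧ e k = e₀ ∧ i < j ∧
        j < k := by
      let q := ({i | e i = e₀} : Finset _).orderEmbOfFin rfl
      have hq : ∀ l, e (q l) = e₀ := fun l => 
        (Finset.mem_filter.1 (({i | e i = e₀} : Finset _).orderEmbOfFin_mem rfl l)).2
      exact ⟨q ⟨0, by omega⟩, q ⟨1, by omega⟩, q ⟨2, by omega⟩, hq _, hq _, hq _,
        q.strictMono (by simp), q.strictMono (by simp)⟩
    obtain ⟨a, hae, hai⟩ := (he i).1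
    obtain ⟨b, hbe, hbk⟩ := (he k).1
    have h1 : a ≤ p j.castSucc := hai.2.trans (p.monotone (Fin.succ_le_castSucc_iff.2 hij))
    have h2 : p j.succ ≤ b := (p.monotone (Fin.succ_le_castSucc_iff.2 hjk)).trans hbk.1
    have hlt : a < b := (h1.trans_lt (p.strictMono Fin.castSucc_lt_succ)).trans_le h2
    rw [hi] at hae
    rw [hk] at hbe
    obtain ⟨β, hβ, hd⟩ := h e₀ (hE.mem_toFinset.1 e₀.2) a hae b hbe hlt.ne
    refine (he j).2 β hβ (hd.mono fun z hz => ?_)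
    rw [hj] at hz
    exact ⟨hz.1, h1.trans hz.2.1, hz.2.2.trans h2⟩

/-- If all intervals of dimension less than `Λ` have dimension less than `δ`, where `δ + 1 < Λ`,
then the iterated condensations are constant from `δ` on: a proper step would exhibit an interval
whose dimension is `δ` or `δ + 1`. -/
theorem fcRel_eq_of_dimLE_gap {δ Λ : Ordinal.{u}} (hδ : δ + 1 < Λ)
    (h : ∀ x y : A, ∀ α < Λ, DimLE (· ≤ ·) α (Set.Icc x y) →
      ∃ γ < δ, DimLE (· ≤ ·) γ (Set.Icc x y)) {β : Ordinal.{u}} (hβ : δ ≤ β) :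
    fcRel A β = fcRel A δ := by
  have hle : ∀ x y : A, x ≤ y → fcRel A (δ + 1) x y → fcRel A δ x y := fun x y hxy hr => by
    obtain ⟨γ, hγ, hd⟩ := h x y (δ + 1) hδ (dimLE_Icc_of_fcRel hr)
    exact (fcRel_spec δ).2 _ (Order.add_one_le_of_lt hγ) _ _ (fcRel_add_one_of_dimLE hxy hd)
  have hstep : fcRel A (δ + 1) = fcRel A δ := by
    ext x y
    refine ⟨fun hr => ?_, (fcRel_spec _).2 _ le_self_add x y⟩
    rcases le_total x y with hxy | hxy
    · exact hle x y hxy hr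
    · exact (fcRel_spec δ).1.1.symm (hle y x hxy ((fcRel_spec _).1.1.symm hr))
  induction β using Ordinal.limitRecOn with
  | zero => rw [le_antisymm hβ zero_le]
  | add_one β ih =>
    rcases hβ.lt_or_eq with hlt | rfl
    · rw [fcRel_add_one, ih (Order.lt_add_one_iff.1 hlt), ← fcRel_add_one, hstep]
    · rfl
  | limit β hl ih =>
    ext x y
    refine ⟨fun hr => ?_, (fcRel_spec _).2 _ hβ x y⟩
    rw [fcRel_limit _ hl] at hr
    obtain ⟨γ, hγ, hr⟩ := hr
    have hm : max γ δ ≤ β := max_le hγ.le hβ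
    have := (fcRel_spec (max γ δ)).2 _ (le_max_left _ _) _ _ hr
    rcases le_total γ δ with h' | h'
    · rwa [max_eq_right h'] at this
    · rw [max_eq_left h', ih γ hγ h'] at this
      exact this

/-- Under the hypotheses of `fcRel_eq_of_dimLE_gap`, a linear order that has a dimension at all
has dimension at most `δ + 1`. -/
theorem dimLE_univ_of_dimLE_gap {δ Λ : Ordinal.{u}} (hδ : δ + 1 < Λ)
    (h : ∀ x y : A, ∀ α < Λ, DimLE (· ≤ ·) α (Set.Icc x y) →
      ∃ γ < δ, DimLE (· ≤ ·) γ (Set.Icc x y)) {α : Ordinal.{u}}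
    (hα : DimLE (· ≤ ·) α (Set.univ : Set A)) :
    DimLE (· ≤ ·) (δ + 1) (Set.univ : Set A) := by
  have hle : ∀ x y : A, DimLE (· ≤ ·) δ (Set.Icc x y) := fun x y => by
    rcases le_or_gt x y with hxy | hxy
    · have hr := fcRel_add_one_of_dimLE hxy (hα.mono (Set.subset_univ _))
      have hr := (fcRel_spec (max (α + 1) δ)).2 _ (le_max_left _ _) _ _ hr
      rw [fcRel_eq_of_dimLE_gap hδ h (le_max_right _ _)] at hr
      exact dimLE_Icc_of_fcRel hr
    · exact dimLE_of_finite (Set.Icc_eq_empty hxy.not_ge ▸ Set.finite_empty) _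
  rw [dimLE_iff]
  refine ⟨{Set.univ}, Set.finite_singleton _, by simp, ?_⟩
  rintro e rfl x - y - -
  exact ⟨δ, Order.lt_add_one_iff.2 le_rfl, (hle x y).mono fun z hz => hz.2⟩

end Condensation

/-! ### Natural sums -/

section NatSum

universe w
open Ordinal

/-- `NatSumLE a b c` says that the natural (Hessenberg) sum of `a` and `b` is at most `c`. -/
def NatSumLE (a b c : Ordinal.{w}) : Prop :=
  (∀ a', ∀ _ : a' < a, ∃ c' < c, NatSumLE a' b c') ∧ ∀ b', ∀ _ : b' < b, ∃ c' < c, NatSumLE a b' c'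
termination_by (a, b)

theorem natSumLE_iff {a b c : Ordinal.{w}} : NatSumLE a b c ↔
    (∀ a' < a, ∃ c' < c, NatSumLE a' b c') ∧ ∀ b' < b, ∃ c' < c, NatSumLE a b' c' := by
  conv_lhs => rw [NatSumLE]

theorem NatSumLE.le_left {a b c : Ordinal.{w}} (h : NatSumLE a b c) : a ≤ c := by
  induction a using WellFoundedLT.induction generalizing c with
  | ind a ih =>
    refine le_of_forall_lt fun a' ha' => ?_
    obtain ⟨c', hc', h'⟩ := (natSumLE_iff.1 h).1 a' ha'
    exact (ih a' ha' h').trans_lt hc'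

theorem NatSumLE.le_right {a b c : Ordinal.{w}} (h : NatSumLE a b c) : b ≤ c := by
  induction b using WellFoundedLT.induction generalizing c with
  | ind b ih =>
    refine le_of_forall_lt fun b' hb' => ?_
    obtain ⟨c', hc', h'⟩ := (natSumLE_iff.1 h).2 b' hb'
    exact (ih b' hb' h').trans_lt hc'

/-- An ordinal below a finite multiple of `η`, in terms of quotient and remainder. -/
theorem exists_eq_mul_natCast_add {η a : Ordinal.{w}} {m : ℕ} (h : a < η * m) :
    ∃ n : ℕ, n < m ∧ ∃ d < η, a = η * n + d := by
  have hη : η ≠ 0 := by rintro rfl; simp at h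
  have hq : a / η < m := (Ordinal.lt_mul_iff_div_lt hη).1 h
  obtain ⟨n, hn⟩ := Ordinal.lt_omega0.1 (hq.trans (Ordinal.natCast_lt_omega0 m))
  rw [hn] at hq
  refine ⟨n, by exact_mod_cast hq, a % η, Ordinal.mod_lt a hη, ?_⟩
  rw [← hn, Ordinal.div_add_mod]

theorem mul_natCast_add_lt {η d : Ordinal.{w}} (hd : d < η) {m n : ℕ} (h : m < n) :
    η * m + d < η * n := by
  calc η * m + d < η * m + η := by gcongr
    _ = η * ((m + 1 : ℕ) : Ordinal) := by push_cast; rw [mul_add_one]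
    _ ≤ η * n := by gcongr; exact_mod_cast h

/-- Natural sums with respect to leading terms `η * m`, `η * n`, provided that the ordinals
below `η` are closed under natural sums. -/
theorem NatSumLE.mul_add {η : Ordinal.{w}}
    (hη : ∀ a < η, ∀ b < η, ∃ c < η, NatSumLE a b c) {a b c : Ordinal.{w}} (m n : ℕ)
    (ha : a < η) (hb : b < η) (h : NatSumLE a b c) :
    NatSumLE (η * m + a) (η * n + b) (η * ((m + n : ℕ) : Ordinal) + c) := by
  suffices ∀ x y : Ordinal.{w}, ∀ (m n : ℕ) (a b c : Ordinal.{w}), a < η → b < η → NatSumLE a b c →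
      x = η * m + a → y = η * n + b → NatSumLE x y (η * ((m + n : ℕ) : Ordinal) + c) from
    this _ _ m n a b c ha hb h rfl rfl
  clear ha hb h m n a b c
  intro x
  induction x using WellFoundedLT.induction with
  | ind x ihx =>
  intro y
  induction y using WellFoundedLT.induction with
  | ind y ihy =>
  rintro m n a b c ha hb h rfl rfl
  rw [natSumLE_iff]
  constructor
  · intro x' hx'
    rcases lt_or_ge x' (η * m) with h1 | h1
    · obtain ⟨m', hm', d, hd, rfl⟩ := exists_eq_mul_natCast_add h1
      obtain ⟨c', hc', hs⟩ := hη d hd b hb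
      exact ⟨_, (mul_natCast_add_lt hc' (Nat.add_lt_add_right hm' n)).trans_le le_self_add,
        ihx _ hx' _ m' n d b c' hd hb hs rfl rfl⟩
    · obtain ⟨d, rfl⟩ := exists_add_of_le h1
      have hd : d < a := by simpa using hx'
      obtain ⟨c', hc', hs⟩ := (natSumLE_iff.1 h).1 d hd
      exact ⟨_, by gcongr, ihx _ hx' _ m n d b c' (hd.trans ha) hb hs rfl rfl⟩
  · intro y' hy'
    rcases lt_or_ge y' (η * n) with h1 | h1
    · obtain ⟨n', hn', d, hd, rfl⟩ := exists_eq_mul_natCast_add h1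
      obtain ⟨c', hc', hs⟩ := hη a ha d hd
      exact ⟨_, (mul_natCast_add_lt hc' (Nat.add_lt_add_left hn' m)).trans_le le_self_add,
        ihy _ hy' m n' a d c' ha hd hs rfl rfl⟩
    · obtain ⟨d, rfl⟩ := exists_add_of_le h1
      have hd : d < b := by simpa using hy'
      obtain ⟨c', hc', hs⟩ := (natSumLE_iff.1 h).2 d hd
      exact ⟨_, by gcongr, ihy _ hy' m n a d c' ha (hd.trans hb) hs rfl rfl⟩

/-- Two ordinals below `η * m` and `η * n` have quotients by `η` of at most `m - 1` and `n - 1`, so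
that their natural sum is below `η * (m + n - 1)`. -/
theorem exists_natSumLE_lt_mul {η : Ordinal.{w}}
    (hη : ∀ a < η, ∀ b < η, ∃ c < η, NatSumLE a b c) {a b : Ordinal.{w}} {m n p : ℕ}
    (ha : a < η * m) (hb : b < η * n) (hp : m + n ≤ p + 1) : ∃ c < η * p, NatSumLE a b c := by
  obtain ⟨m', hm, d, hd, rfl⟩ := exists_eq_mul_natCast_add ha
  obtain ⟨n', hn, d', hd', rfl⟩ := exists_eq_mul_natCast_add hb
  obtain ⟨c, hc, h⟩ := hη d hd d' hd'
  exact ⟨_, mul_natCast_add_lt hc (by omega), h.mul_add hη m' n' hd hd'⟩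

theorem exists_lt_opow_mul_natCast {k : ℕ} {a : Ordinal.{w}}
    (ha : a < ω ^ ((k + 1 : ℕ) : Ordinal)) : ∃ m : ℕ, a < ω ^ (k : Ordinal) * m := by
  push_cast at ha
  rw [opow_add, opow_one, Ordinal.lt_mul_iff_of_isSuccLimit isSuccLimit_omega0] at ha
  obtain ⟨c, hc, h⟩ := ha
  obtain ⟨m, rfl⟩ := lt_omega0.1 hc
  exact ⟨m, h⟩

theorem opow_mul_natCast_lt (k m : ℕ) :
    (ω : Ordinal.{w}) ^ (k : Ordinal) * m < ω ^ ((k + 1 : ℕ) : Ordinal) := by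
  push_cast
  rw [opow_add, opow_one]
  exact (mul_lt_mul_iff_right₀ (opow_pos _ omega0_pos)).2 (natCast_lt_omega0 m)

theorem opow_mul_natCast_pos (k : ℕ) {m : ℕ} (hm : 0 < m) :
    0 < (ω : Ordinal.{w}) ^ (k : Ordinal) * m :=
  mul_pos (opow_pos _ omega0_pos) (by exact_mod_cast hm)

/-- The ordinals below `ω ^ k` are closed under natural sums. -/
theorem exists_natSumLE_lt_opow (k : ℕ) : ∀ a < (ω : Ordinal.{w}) ^ (k : Ordinal),
    ∀ b < (ω : Ordinal.{w}) ^ (k : Ordinal), ∃ c < (ω : Ordinal.{w}) ^ (k : Ordinal),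
      NatSumLE a b c := by
  induction k with
  | zero =>
    intro a ha b hb
    have ha : a = 0 := by simpa using ha
    have hb : b = 0 := by simpa using hb
    subst ha hb
    refine ⟨0, by simp, ?_⟩
    rw [natSumLE_iff]
    simp
  | succ k ih =>
    intro a ha b hb
    obtain ⟨m, hm⟩ := exists_lt_opow_mul_natCast ha
    obtain ⟨n, hn⟩ := exists_lt_opow_mul_natCast hb
    obtain ⟨c, hc, h⟩ := exists_natSumLE_lt_mul ih hm hn (Nat.le_succ _)
    exact ⟨c, hc.trans (opow_mul_natCast_lt k _), h⟩

end NatSum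

/-! ### Boxes -/

section Box

universe w
variable {X Y K L : Type*}

/-- The relation `r` is a linear order on the set `s`. -/
structure IsLin (r : X → X → Prop) (s : Set X) : Prop where
  refl : ∀ x ∈ s, r x x
  antisymm : ∀ x ∈ s, ∀ y ∈ s, r x y → r y x → x = y
  trans : ∀ x ∈ s, ∀ y ∈ s, ∀ z ∈ s, r x y → r y z → r x z
  total : ∀ x ∈ s, ∀ y ∈ s, r x y ∨ r y x

theorem IsLin.mono {r : X → X → Prop} {s t : Set X} (h : IsLin r t) (hst : s ⊆ t) : IsLin r s :=
  ⟨fun x hx => h.refl x (hst hx), fun x hx y hy => h.antisymm x (hst hx) y (hst hy),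
    fun x hx y hy z hz => h.trans x (hst hx) y (hst hy) z (hst hz),
    fun x hx y hy => h.total x (hst hx) y (hst hy)⟩

theorem IsLin.flip {r : X → X → Prop} {s : Set X} (h : IsLin r s) : IsLin (flip r) s :=
  ⟨h.refl, fun x hx y hy h1 h2 => h.antisymm x hx y hy h2 h1,
    fun x hx y hy z hz h1 h2 => h.trans z hz y hy x hx h2 h1, fun x hx y hy => h.total y hy x hx⟩

theorem IsLin.comap {r : X → X → Prop} {r' : Y → Y → Prop} {s : Set X} {t : Set Y}
    (h : IsLin r' t) (f : X → Y) (hf : Set.InjOn f s) (hst : Set.MapsTo f s t)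
    (hr : ∀ x ∈ s, ∀ y ∈ s, r x y ↔ r' (f x) (f y)) : IsLin r s where
  refl x hx := (hr x hx x hx).2 (h.refl _ (hst hx))
  antisymm x hx y hy h1 h2 := hf hx hy
    (h.antisymm _ (hst hx) _ (hst hy) ((hr x hx y hy).1 h1) ((hr y hy x hx).1 h2))
  trans x hx y hy z hz h1 h2 := (hr x hx z hz).2
    (h.trans _ (hst hx) _ (hst hy) _ (hst hz) ((hr x hx y hy).1 h1) ((hr y hy z hz).1 h2))
  total x hx y hy := by
    rw [hr x hx y hy, hr y hy x hx]
    exact h.total _ (hst hx) _ (hst hy)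

/-- In a linear order, one of the colour classes of a finite colouring is cofinal. -/
theorem IsLin.exists_cofinal_fiber [Finite K] {r : X → X → Prop} {s : Set X} (h : IsLin r s)
    (hs : s.Nonempty) (g : X → K) : ∃ κ, ∀ x ∈ s, ∃ x' ∈ s, r x x' ∧ g x' = κ := by
  by_contra! hcon
  choose b hb hb' using hcon
  have : Nonempty K := hs.elim fun x _ => ⟨g x⟩
  have : Nonempty s := hs.to_subtype
  have htr : IsTrans s fun x y => r x y := ⟨fun x y z => h.trans x x.2 y y.2 z z.2⟩
  have hdir : Directed (fun x y : s => r x y) (id : s → s) := fun x y => by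
    rcases h.total x x.2 y y.2 with hxy | hxy
    · exact ⟨y, hxy, h.refl y y.2⟩
    · exact ⟨x, h.refl x x.2, hxy⟩
  obtain ⟨z, hz⟩ := hdir.finite_le fun κ => ⟨b κ, hb κ⟩
  exact hb' (g z) z z.2 (hz (g z)) rfl

/-- The relation `r` makes `s ×ˢ t` a linear order which induces `rX` on all lines in the first
direction and `rY` on all lines in the second one, and which is determined by colours of the pairs
of first and of second components. (Without the finiteness of the sets of colours, boxes with small
sides could be dense: order `ℤ × ℤ` by the values of `x + √2 * y`.) -/
structure IsBox (r : X × Y → X × Y → Prop) (rX : X → X → Prop) (rY : Y → Y → Prop)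
    (cX : X → X → K) (cY : Y → Y → L) (G : K → L → Prop) (s : Set X) (t : Set Y) : Prop where
  lin : IsLin r (s ×ˢ t)
  linX : IsLin rX s
  linY : IsLin rY t
  lineX : ∀ x ∈ s, ∀ x' ∈ s, ∀ y ∈ t, r (x, y) (x', y) ↔ rX x x'
  lineY : ∀ x ∈ s, ∀ y ∈ t, ∀ y' ∈ t, r (x, y) (x, y') ↔ rY y y'
  colour : ∀ x ∈ s, ∀ x' ∈ s, ∀ y ∈ t, ∀ y' ∈ t, r (x, y) (x', y') ↔ G (cX x x') (cY y y')

variable {r : X × Y → X × Y → Prop} {rX : X → X → Prop} {rY : Y → Y → Prop}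
  {cX : X → X → K} {cY : Y → Y → L} {G : K → L → Prop} {s : Set X} {t : Set Y}

theorem IsBox.mono (h : IsBox r rX rY cX cY G s t) {s' : Set X} {t' : Set Y} (hs : s' ⊆ s)
    (ht : t' ⊆ t) : IsBox r rX rY cX cY G s' t' :=
  ⟨h.lin.mono (Set.prod_mono hs ht), h.linX.mono hs, h.linY.mono ht,
    fun x hx x' hx' y hy => h.lineX x (hs hx) x' (hs hx') y (ht hy),
    fun x hx y hy y' hy' => h.lineY x (hs hx) y (ht hy) y' (ht hy'),
    fun x hx x' hx' y hy y' hy' => h.colour x (hs hx) x' (hs hx') y (ht hy) y' (ht hy')⟩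

theorem IsBox.flip (h : IsBox r rX rY cX cY G s t) :
    IsBox (flip r) (flip rX) (flip rY) (flip cX) (flip cY) G s t :=
  ⟨h.lin.flip, h.linX.flip, h.linY.flip, fun x hx x' hx' y hy => h.lineX x' hx' x hx y hy,
    fun x hx y hy y' hy' => h.lineY x hx y' hy' y hy,
    fun x hx x' hx' y hy y' hy' => h.colour x' hx' x hx y' hy' y hy⟩

/-- The order of a box extends the componentwise order. -/
theorem IsBox.le (h : IsBox r rX rY cX cY G s t) {x x' : X} {y y' : Y} (hx : x ∈ s) (hx' : x' ∈ s)
    (hy : y ∈ t) (hy' : y' ∈ t) (h1 : rX x x') (h2 : rY y y') : r (x, y) (x', y') :=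
  h.lin.trans (x, y) ⟨hx, hy⟩ (x', y) ⟨hx', hy⟩ (x', y') ⟨hx', hy'⟩
    ((h.lineX x hx x' hx' y hy).2 h1) ((h.lineY x' hx' y hy y' hy').2 h2)

/-- A box whose sides have least elements: the initial segment below `(a, b)` is covered by the
smaller boxes of the pairs `(x, y)` with `x ≤ a` and of those with `y ≤ b`. -/
theorem IsBox.dimLE_of_least_of_least {c : Ordinal.{w}} (h : IsBox r rX rY cX cY G s t)
    (hX : ∀ x ∈ s, ∀ x' ∈ s, ∃ c' < c, DimLE r c' ({z | z ∈ s ∧ rX x z ∧ rX z x'} ×ˢ t))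
    (hY : ∀ y ∈ t, ∀ y' ∈ t, ∃ c' < c, DimLE r c' (s ×ˢ {z | z ∈ t ∧ rY y z ∧ rY z y'}))
    {x₀ : X} (hx₀ : x₀ ∈ s) (hx₀' : ∀ x ∈ s, rX x₀ x)
    {y₀ : Y} (hy₀ : y₀ ∈ t) (hy₀' : ∀ y ∈ t, rY y₀ y) : DimLE r c (s ×ˢ t) := by
  rw [dimLE_iff]
  refine ⟨{s ×ˢ t}, Set.finite_singleton _, by simp, ?_⟩
  rintro _ rfl z - ⟨a, b⟩ ⟨ha, hb⟩ -
  obtain ⟨c₁, hc₁, h₁⟩ := hX x₀ hx₀ a ha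
  obtain ⟨c₂, hc₂, h₂⟩ := hY y₀ hy₀ b hb
  refine ⟨max c₁ c₂, max_lt hc₁ hc₂,
    ((h₁.mono_rank (le_max_left _ _)).union (h₂.mono_rank (le_max_right _ _))).mono ?_⟩
  rintro ⟨x, y⟩ ⟨⟨hx, hy⟩, -, hle⟩
  rcases h.linX.total x hx a ha with hxa | hxa
  · exact .inl ⟨⟨hx, hx₀' x hx, hxa⟩, hy⟩
  · rcases h.linY.total y hy b hb with hyb | hyb
    · exact .inr ⟨hx, hy, hy₀' y hy, hyb⟩
    · have heq := h.lin.antisymm (x, y) ⟨hx, hy⟩ (a, b) ⟨ha, hb⟩ hle (h.le ha hx hb hy hxa hyb)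
      obtain ⟨rfl, rfl⟩ := Prod.ext_iff.1 heq
      exact .inl ⟨⟨hx, hx₀' _ hx, h.linX.refl _ hx⟩, hy⟩

/-- A box whose first side has a least and whose second side has a greatest element. By the
pigeonhole principle there are colours `κ` and `l` such that cofinally many `x` have colour `κ` with
cofinally many `x'`, and coinitially many `y` have colour `l` with coinitially many `y'`. If
`G κ l` holds, all initial segments are covered by smaller boxes, otherwise all final ones. -/
theorem IsBox.dimLE_of_least_of_greatest [Finite K] [Finite L] {c : Ordinal.{w}}
    (h : IsBox r rX rY cX cY G s t)
    (hX : ∀ x ∈ s, ∀ x' ∈ s, ∃ c' < c, DimLE r c' ({z | z ∈ s ∧ rX x z ∧ rX z x'} ×ˢ t))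
    (hY : ∀ y ∈ t, ∀ y' ∈ t, ∃ c' < c, DimLE r c' (s ×ˢ {z | z ∈ t ∧ rY y z ∧ rY z y'}))
    {x₀ : X} (hx₀ : x₀ ∈ s) (hx₀' : ∀ x ∈ s, rX x₀ x)
    {y₀ : Y} (hy₀ : y₀ ∈ t) (hy₀' : ∀ y ∈ t, rY y y₀) : DimLE r c (s ×ˢ t) := by
  choose kX hkX using fun x => h.linX.exists_cofinal_fiber ⟨x₀, hx₀⟩ (cX x)
  obtain ⟨κ, hκ⟩ := h.linX.exists_cofinal_fiber ⟨x₀, hx₀⟩ kX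
  choose kY hkY using fun y => h.linY.flip.exists_cofinal_fiber ⟨y₀, hy₀⟩ (cY y)
  obtain ⟨l, hl⟩ := h.linY.flip.exists_cofinal_fiber ⟨y₀, hy₀⟩ kY
  by_cases hG : G κ l
  · obtain ⟨y₁, hy₁, -, hy₁l⟩ := hl y₀ hy₀
    have hlow : DimLE r c (s ×ˢ {y | y ∈ t ∧ rY y y₁}) := by
      rw [dimLE_iff]
      refine ⟨{s ×ˢ {y | y ∈ t ∧ rY y y₁}}, Set.finite_singleton _, by simp, ?_⟩
      rintro _ rfl z - ⟨a, b⟩ ⟨ha, hb, hb₁⟩ -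
      obtain ⟨x, hx, hax, hxκ⟩ := hκ a ha
      obtain ⟨x', hx', hxx', hxc⟩ := hkX x x hx
      obtain ⟨c', hc', hd⟩ := hX x₀ hx₀ x' hx'
      refine ⟨c', hc', hd.mono ?_⟩
      rintro ⟨u, v⟩ ⟨⟨hu, hv, -⟩, -, huv⟩
      refine ⟨⟨hu, hx₀' u hu, ?_⟩, hv⟩
      refine (h.linX.total u hu x' hx').elim id fun hx'u => ?_
      obtain ⟨y', hy', hy'v, hyc⟩ := hkY y₁ v hv
      have h1 : r (a, b) (x, y₁) := h.le ha hx hb hy₁ hax hb₁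
      have h2 : r (x, y₁) (x', y') := by
        rw [h.colour x hx x' hx' y₁ hy₁ y' hy', hxc, hxκ, hyc, hy₁l]
        exact hG
      have h3 : r (x', y') (u, v) := h.le hx' hu hy' hv hx'u hy'v
      have h4 : r (u, v) (x, y₁) := h.lin.trans (u, v) ⟨hu, hv⟩ (a, b) ⟨ha, hb⟩ (x, y₁) ⟨hx, hy₁⟩
        huv h1
      have h5 : r (x, y₁) (u, v) := h.lin.trans (x, y₁) ⟨hx, hy₁⟩ (x', y') ⟨hx', hy'⟩ (u, v)
        ⟨hu, hv⟩ h2 h3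
      obtain ⟨rfl, -⟩ := Prod.ext_iff.1 (h.lin.antisymm (u, v) ⟨hu, hv⟩ (x, y₁) ⟨hx, hy₁⟩ h4 h5)
      exact hxx'
    obtain ⟨c', hc', hd⟩ := hY y₁ hy₁ y₀ hy₀
    refine (hlow.union (hd.mono_rank hc'.le)).mono ?_
    rintro ⟨x, y⟩ ⟨hx, hy⟩
    rcases h.linY.total y hy y₁ hy₁ with h' | h'
    · exact .inl ⟨hx, hy, h'⟩
    · exact .inr ⟨hx, hy, h', hy₀' y hy⟩
  · obtain ⟨x₁, hx₁, -, hx₁κ⟩ := hκ x₀ hx₀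
    have hhigh : DimLE r c ({x | x ∈ s ∧ rX x₁ x} ×ˢ t) := by
      rw [dimLE_iff]
      refine ⟨{{x | x ∈ s ∧ rX x₁ x} ×ˢ t}, Set.finite_singleton _, by simp, ?_⟩
      rintro _ rfl ⟨a, b⟩ ⟨⟨ha, ha₁⟩, hb⟩ z - -
      obtain ⟨y, hy, hby, hyl⟩ := hl b hb
      obtain ⟨y', hy', hyy', hyc⟩ := hkY y y hy
      obtain ⟨c', hc', hd⟩ := hY y' hy' y₀ hy₀
      refine ⟨c', hc', hd.mono ?_⟩
      rintro ⟨u, v⟩ ⟨⟨⟨hu, -⟩, hv⟩, huv, -⟩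
      refine ⟨hu, hv, ?_, hy₀' v hv⟩
      refine (h.linY.total y' hy' v hv).elim id fun hvy' => ?_
      obtain ⟨x', hx', hux', hxc⟩ := hkX x₁ u hu
      have h1 : r (x₁, y) (a, b) := h.le hx₁ ha hy hb ha₁ hby
      have h2 : r (x', y') (x₁, y) := by
        refine (h.lin.total (x₁, y) ⟨hx₁, hy⟩ (x', y') ⟨hx', hy'⟩).resolve_left fun h2 => hG ?_
        rwa [h.colour x₁ hx₁ x' hx' y hy y' hy', hxc, hx₁κ, hyc, hyl] at h2
      have h3 : r (u, v) (x', y') := h.le hu hx' hv hy' hux' hvy'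
      have h4 : r (x₁, y) (u, v) := h.lin.trans (x₁, y) ⟨hx₁, hy⟩ (a, b) ⟨ha, hb⟩ (u, v) ⟨hu, hv⟩
        h1 huv
      have h5 : r (u, v) (x₁, y) := h.lin.trans (u, v) ⟨hu, hv⟩ (x', y') ⟨hx', hy'⟩ (x₁, y)
        ⟨hx₁, hy⟩ h3 h2
      obtain ⟨-, rfl⟩ := Prod.ext_iff.1 (h.lin.antisymm (u, v) ⟨hu, hv⟩ (x₁, y) ⟨hx₁, hy⟩ h5 h4)
      exact hyy'
    obtain ⟨c', hc', hd⟩ := hX x₀ hx₀ x₁ hx₁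
    refine (hhigh.union (hd.mono_rank hc'.le)).mono ?_
    rintro ⟨x, y⟩ ⟨hx, hy⟩
    rcases h.linX.total x₁ hx₁ x hx with h' | h'
    · exact .inl ⟨⟨hx, h'⟩, hy⟩
    · exact .inr ⟨⟨hx, hx₀' x hx, h'⟩, hy⟩

theorem finite_of_dimLE_zero {r : X → X → Prop} {s : Set X} (h : DimLE r (0 : Ordinal.{w}) s) :
    s.Finite := by
  rw [dimLE_iff] at h
  obtain ⟨E, hE, hs, h⟩ := h
  refine (hE.sUnion fun e he => Set.Subsingleton.finite fun x hx y hy => ?_).subset hs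
  by_contra hxy
  obtain ⟨β, hβ, -⟩ := h e he x hx y hy hxy
  exact not_lt_bot hβ

/-- The dimension of a coloured box is at most the natural sum of the dimensions of its sides. By
induction one may restrict to pieces of the two sides in which intervals have smaller dimension;
cut at a point, such a piece has a least or a greatest element. -/
theorem IsBox.dimLE [Finite K] [Finite L] {a b c : Ordinal.{w}} (h : IsBox r rX rY cX cY G s t)
    (hs : DimLE rX a s) (ht : DimLE rY b t) (habc : NatSumLE a b c) : DimLE r c (s ×ˢ t) := by
  induction a using WellFoundedLT.induction generalizing b c s t with
  | ind a iha =>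
  induction b using WellFoundedLT.induction generalizing c s t with
  | ind b ihb =>
  rcases eq_or_ne a 0 with rfl | ha0
  · refine (DimLE.biUnion (finite_of_dimLE_zero hs) (s := fun x => {x} ×ˢ t) fun x hx => ?_).mono
      fun z hz => Set.mem_biUnion hz.1 ⟨rfl, hz.2⟩
    refine (ht.mono_rank habc.le_right).comap Prod.snd ?_ (fun z hz => hz.2) ?_
    · rintro ⟨_, y⟩ ⟨rfl, hy⟩ ⟨_, y'⟩ ⟨rfl, hy'⟩ hyy'
      exact Prod.ext rfl hyy'
    · rintro ⟨_, y⟩ ⟨rfl, hy⟩ ⟨_, y'⟩ ⟨rfl, hy'⟩ hyy'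
      exact (h.lineY _ hx y hy y' hy').1 hyy'
  rcases eq_or_ne b 0 with rfl | hb0
  · refine (DimLE.biUnion (finite_of_dimLE_zero ht) (s := fun y => s ×ˢ {y}) fun y hy => ?_).mono
      fun z hz => Set.mem_biUnion hz.2 ⟨hz.1, rfl⟩
    refine (hs.mono_rank habc.le_left).comap Prod.fst ?_ (fun z hz => hz.1) ?_
    · rintro ⟨x, _⟩ ⟨hx, rfl⟩ ⟨x', _⟩ ⟨hx', rfl⟩ hxx'
      exact Prod.ext hxx' rfl
    · rintro ⟨x, _⟩ ⟨hx, rfl⟩ ⟨x', _⟩ ⟨hx', rfl⟩ hxx'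
      exact (h.lineX x hx x' hx' _ hy).1 hxx'
  have ha0 : 0 < a := pos_iff_ne_zero.2 ha0
  have hb0 : 0 < b := pos_iff_ne_zero.2 hb0
  rw [dimLE_iff] at hs ht
  obtain ⟨E, hE, hsE, hs⟩ := hs
  obtain ⟨F, hF, htF, ht⟩ := ht
  rw [natSumLE_iff] at habc
  -- It suffices to consider one piece of each side, cut at a point.
  refine (DimLE.biUnion (hE.prod hF) (s := fun p => (s ∩ p.1) ×ˢ (t ∩ p.2)) ?_).mono ?_
  swap
  · rintro ⟨x, y⟩ ⟨hx, hy⟩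
    obtain ⟨e, he, hxe⟩ := hsE hx
    obtain ⟨f, hf, hyf⟩ := htF hy
    exact Set.mem_biUnion (x := (e, f)) ⟨he, hf⟩ ⟨⟨hx, hxe⟩, hy, hyf⟩
  rintro ⟨e, f⟩ ⟨he, hf⟩
  rcases Set.eq_empty_or_nonempty (s ∩ e) with h0 | ⟨x₀, hx₀⟩
  · simpa [h0] using dimLE_of_finite Set.finite_empty c
  rcases Set.eq_empty_or_nonempty (t ∩ f) with h0 | ⟨y₀, hy₀⟩
  · simpa [h0] using dimLE_of_finite Set.finite_empty c
  have hX : ∀ e' ⊆ s ∩ e, ∀ f' ⊆ t ∩ f, ∀ x ∈ e', ∀ x' ∈ e',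
      ∃ c' < c, DimLE r c' ({z | z ∈ e' ∧ rX x z ∧ rX z x'} ×ˢ f') := by
    intro e' he' f' hf' x hx x' hx'
    obtain ⟨a', ha', hd⟩ : ∃ a' < a, DimLE rX a' {z | z ∈ e' ∧ rX x z ∧ rX z x'} := by
      by_cases hxx' : x = x'
      · subst hxx'
        refine ⟨0, ha0, dimLE_of_finite ((Set.finite_singleton x).subset fun z hz => ?_) _⟩
        exact h.linX.antisymm z (he' hz.1).1 x (he' hx).1 hz.2.2 hz.2.1
      · obtain ⟨a', ha', hd⟩ := hs e he x (he' hx).2 x' (he' hx').2 hxx'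
        exact ⟨a', ha', hd.mono fun z hz => ⟨(he' hz.1).2, hz.2⟩⟩
    obtain ⟨c', hc', hn⟩ := habc.1 a' ha'
    exact ⟨c', hc', iha a' ha' (h.mono (fun z hz => (he' hz.1).1) fun z hz => (hf' hz).1) hd
      ((dimLE_iff.2 ⟨F, hF, htF, ht⟩ : DimLE rY b t).mono fun z hz => (hf' hz).1) hn⟩
  have hY : ∀ e' ⊆ s ∩ e, ∀ f' ⊆ t ∩ f, ∀ y ∈ f', ∀ y' ∈ f',
      ∃ c' < c, DimLE r c' (e' ×ˢ {z | z ∈ f' ∧ rY y z ∧ rY z y'}) := by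
    intro e' he' f' hf' y hy y' hy'
    obtain ⟨b', hb', hd⟩ : ∃ b' < b, DimLE rY b' {z | z ∈ f' ∧ rY y z ∧ rY z y'} := by
      by_cases hyy' : y = y'
      · subst hyy'
        refine ⟨0, hb0, dimLE_of_finite ((Set.finite_singleton y).subset fun z hz => ?_) _⟩
        exact h.linY.antisymm z (hf' hz.1).1 y (hf' hy).1 hz.2.2 hz.2.1
      · obtain ⟨b', hb', hd⟩ := ht f hf y (hf' hy).2 y' (hf' hy').2 hyy'
        exact ⟨b', hb', hd.mono fun z hz => ⟨(hf' hz.1).2, hz.2⟩⟩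
    obtain ⟨c', hc', hn⟩ := habc.2 b' hb'
    exact ⟨c', hc', ihb b' hb' (h.mono (fun z hz => (he' hz).1) fun z hz => (hf' hz.1).1)
      ((dimLE_iff.2 ⟨E, hE, hsE, hs⟩ : DimLE rX a s).mono fun z hz => (he' hz).1) hd hn⟩
  have hXf : ∀ e' ⊆ s ∩ e, ∀ f' ⊆ t ∩ f, ∀ x ∈ e', ∀ x' ∈ e',
      ∃ c' < c, DimLE (_root_.flip r) c'
        ({z | z ∈ e' ∧ _root_.flip rX x z ∧ _root_.flip rX z x'} ×ˢ f') := by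
    intro e' he' f' hf' x hx x' hx'
    obtain ⟨c', hc', hd⟩ := hX e' he' f' hf' x' hx' x hx
    exact ⟨c', hc', hd.flip.mono fun z hz => ⟨⟨hz.1.1, hz.1.2.2, hz.1.2.1⟩, hz.2⟩⟩
  have hYf : ∀ e' ⊆ s ∩ e, ∀ f' ⊆ t ∩ f, ∀ y ∈ f', ∀ y' ∈ f',
      ∃ c' < c, DimLE (_root_.flip r) c'
        (e' ×ˢ {z | z ∈ f' ∧ _root_.flip rY y z ∧ _root_.flip rY z y'}) := by
    intro e' he' f' hf' y hy y' hy'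
    obtain ⟨c', hc', hd⟩ := hY e' he' f' hf' y' hy' y hy
    exact ⟨c', hc', hd.flip.mono fun z hz => ⟨hz.1, hz.2.1, hz.2.2.2, hz.2.2.1⟩⟩
  let e₁ := {x | x ∈ s ∩ e ∧ rX x₀ x}
  let e₂ := {x | x ∈ s ∩ e ∧ rX x x₀}
  let f₁ := {y | y ∈ t ∩ f ∧ rY y₀ y}
  let f₂ := {y | y ∈ t ∩ f ∧ rY y y₀}
  have he₁ : e₁ ⊆ s ∩ e := fun x hx => hx.1
  have he₂ : e₂ ⊆ s ∩ e := fun x hx => hx.1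
  have hf₁ : f₁ ⊆ t ∩ f := fun x hx => hx.1
  have hf₂ : f₂ ⊆ t ∩ f := fun x hx => hx.1
  have hxr := h.linX.refl x₀ hx₀.1
  have hyr := h.linY.refl y₀ hy₀.1
  have hbox : ∀ e' ⊆ s ∩ e, ∀ f' ⊆ t ∩ f, IsBox r rX rY cX cY G e' f' := fun e' he' f' hf' =>
    h.mono (fun z hz => (he' hz).1) fun z hz => (hf' hz).1
  have h₁₁ : DimLE r c (e₁ ×ˢ f₁) := (hbox e₁ he₁ f₁ hf₁).dimLE_of_least_of_least
    (hX e₁ he₁ f₁ hf₁) (hY e₁ he₁ f₁ hf₁) ⟨hx₀, hxr⟩ (fun x hx => hx.2) ⟨hy₀, hyr⟩ fun y hy => hy.2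
  have h₁₂ : DimLE r c (e₁ ×ˢ f₂) := (hbox e₁ he₁ f₂ hf₂).dimLE_of_least_of_greatest
    (hX e₁ he₁ f₂ hf₂) (hY e₁ he₁ f₂ hf₂) ⟨hx₀, hxr⟩ (fun x hx => hx.2) ⟨hy₀, hyr⟩ fun y hy => hy.2
  have h₂₂ : DimLE (_root_.flip r) c (e₂ ×ˢ f₂) := (hbox e₂ he₂ f₂ hf₂).flip.dimLE_of_least_of_least
    (hXf e₂ he₂ f₂ hf₂) (hYf e₂ he₂ f₂ hf₂) ⟨hx₀, hxr⟩ (fun x hx => hx.2) ⟨hy₀, hyr⟩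
    fun y hy => hy.2
  have h₂₁ : DimLE (_root_.flip r) c (e₂ ×ˢ f₁) :=
    (hbox e₂ he₂ f₁ hf₁).flip.dimLE_of_least_of_greatest (hXf e₂ he₂ f₁ hf₁)
    (hYf e₂ he₂ f₁ hf₁) ⟨hx₀, hxr⟩ (fun x hx => hx.2) ⟨hy₀, hyr⟩
    fun y hy => hy.2
  refine (((h₁₁.union h₁₂).union h₂₁.flip).union h₂₂.flip).mono ?_
  rintro ⟨x, y⟩ ⟨hx, hy⟩
  rcases h.linX.total x₀ hx₀.1 x hx.1 with hx' | hx' <;>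
    rcases h.linY.total y₀ hy₀.1 y hy.1 with hy' | hy'
  · exact .inl (.inl (.inl ⟨⟨hx, hx'⟩, hy, hy'⟩))
  · exact .inl (.inl (.inr ⟨⟨hx, hx'⟩, hy, hy'⟩))
  · exact .inl (.inr ⟨⟨hx, hx'⟩, hy, hy'⟩)
  · exact .inr ⟨⟨hx, hx'⟩, hy, hy'⟩

end Box

/-! ### Derivatives of binary trees -/

section Derivative

/-- `T` is closed under prefixes. -/
def PrefixClosed (T : Set (List Bool)) : Prop := ∀ u v, u <+: v → v ∈ T → u ∈ T

/-- The subtree of `T` below the child `b` of the root. -/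
def subtree (b : Bool) (T : Set (List Bool)) : Set (List Bool) := {u | b :: u ∈ T}

theorem PrefixClosed.subtree {T : Set (List Bool)} (hT : PrefixClosed T) (b : Bool) :
    PrefixClosed (subtree b T) := fun u v huv hv =>
  hT (b :: u) (b :: v) (by simpa using huv) hv

theorem IsInfiniteBranch.mono {S T P : Set (List Bool)} (h : IsInfiniteBranch S P) (hST : S ⊆ T) :
    IsInfiniteBranch T P :=
  ⟨h.1.trans hST, h.2⟩

theorem derivative_mono {S T : Set (List Bool)} (h : S ⊆ T) : derivative S ⊆ derivative T :=
  fun _ ⟨hu, P, Q, hP, hQ, h'⟩ => ⟨h hu, P, Q, hP.mono h, hQ.mono h, h'⟩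

theorem PrefixClosed.derivative {T : Set (List Bool)} (hT : PrefixClosed T) :
    PrefixClosed (derivative T) :=
  fun u v huv ⟨hv, P, Q, hP, hQ, h, hvP, hvQ⟩ =>
    ⟨hT u v huv hv, P, Q, hP, hQ, h, hP.2.2.1 u v huv hvP, hQ.2.2.1 u v huv hvQ⟩

theorem PrefixClosed.iterate_derivative {T : Set (List Bool)} (hT : PrefixClosed T) (n : ℕ) :
    PrefixClosed (TreeAut.derivative^[n] T) := by
  induction n with
  | zero => exact hT
  | succ n ih =>
    rw [Function.iterate_succ_apply']
    exact ih.derivative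

/-- A branch of a subtree, prolonged to the root. -/
theorem IsInfiniteBranch.cons {T P : Set (List Bool)} {b : Bool} (hT : PrefixClosed T)
    (h : IsInfiniteBranch (subtree b T) P) :
    IsInfiniteBranch T (insert [] ((b :: ·) '' P)) := by
  obtain ⟨h1, h2, h3, h4⟩ := h
  refine ⟨?_, ?_, ?_, ?_⟩
  · rintro _ (rfl | ⟨u, hu, rfl⟩)
    · obtain ⟨u, hu⟩ := h2.nonempty
      exact hT [] _ List.nil_prefix (h1 hu)
    · exact h1 hu
  · exact (h2.image (List.cons_injective.injOn)).mono (Set.subset_insert _ _)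
  · rintro u _ huv (rfl | ⟨v, hv, rfl⟩)
    · exact .inl (List.prefix_nil.1 huv)
    · rcases u with _ | ⟨c, u⟩
      · exact .inl rfl
      · obtain ⟨rfl, huv'⟩ := List.cons_prefix_cons.1 huv
        exact .inr ⟨u, h3 u v huv' hv, rfl⟩
  · rintro _ (rfl | ⟨u, hu, rfl⟩) _ (rfl | ⟨v, hv, rfl⟩)
    · exact .inl List.nil_prefix
    · exact .inl List.nil_prefix
    · exact .inr List.nil_prefix
    · simpa using h4 u hu v hv

theorem derivative_subtree_subset {T : Set (List Bool)} (hT : PrefixClosed T) (b : Bool) :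
    derivative (subtree b T) ⊆ subtree b (derivative T) := by
  rintro u ⟨hu, P, Q, hP, hQ, hPQ, huP, huQ⟩
  refine ⟨hu, _, _, hP.cons hT, hQ.cons hT, fun h => hPQ ?_, .inr ⟨u, huP, rfl⟩, .inr ⟨u, huQ, rfl⟩⟩
  ext v
  simpa using Set.ext_iff.1 h (b :: v)

theorem iterate_derivative_subtree_subset {T : Set (List Bool)} (hT : PrefixClosed T) (b : Bool)
    (n : ℕ) : derivative^[n] (subtree b T) ⊆ subtree b (derivative^[n] T) := by
  induction n with
  | zero => exact subset_rfl
  | succ n ih =>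
    rw [Function.iterate_succ_apply', Function.iterate_succ_apply']
    exact (derivative_mono ih).trans (derivative_subtree_subset (hT.iterate_derivative n) b)

/-- Kőnig's lemma for prefix-closed sets of binary words. -/
theorem PrefixClosed.exists_isInfiniteBranch {T : Set (List Bool)} (hT : PrefixClosed T)
    (hinf : T.Infinite) : ∃ P, IsInfiniteBranch T P := by
  have step : ∀ u : {u : List Bool // {v ∈ T | u <+: v}.Infinite},
      ∃ b, {v ∈ T | u.1 ++ [b] <+: v}.Infinite := by
    rintro ⟨u, hu⟩
    by_contra! hcon
    simp only at hcon
    refine hu ((((hcon false).union (hcon true)).insert u).subset ?_)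
    rintro v ⟨hv, w, rfl⟩
    rcases w with _ | ⟨_ | _, w⟩
    · exact .inl (by simp)
    · exact .inr (.inl ⟨hv, w, by simp⟩)
    · exact .inr (.inr ⟨hv, w, by simp⟩)
  choose g hg using step
  let f : ℕ → {u : List Bool // {v ∈ T | u <+: v}.Infinite} :=
    fun n => n.rec ⟨[], by simpa using hinf⟩ fun _ u => ⟨_, hg u⟩
  have hf : ∀ n, (f (n + 1)).1 = (f n).1 ++ [g (f n)] := fun n => rfl
  have hlen : ∀ n, (f n).1.length = n := fun n => by
    induction n with
    | zero => rfl
    | succ n ih => rw [hf, List.length_append, ih, List.length_singleton]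
  have hmono : ∀ m n, m ≤ n → (f m).1 <+: (f n).1 := fun m n hmn => by
    induction n, hmn using Nat.le_induction with
    | base => exact List.prefix_rfl
    | succ n _ ih => exact ih.trans (hf n ▸ List.prefix_append _ _)
  refine ⟨{u | ∃ n, u <+: (f n).1}, ?_, ?_, ?_, ?_⟩
  · rintro u ⟨n, hu⟩
    obtain ⟨v, hv, hfv⟩ := (f n).2.nonempty
    exact hT u v (hu.trans hfv) hv
  · refine (Set.infinite_range_of_injective (f := fun n => (f n).1) fun m n hmn => ?_).mono ?_
    · simpa [hlen] using congrArg List.length hmn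
    · rintro _ ⟨n, rfl⟩
      exact ⟨n, List.prefix_rfl⟩
  · rintro u v huv ⟨n, hn⟩
    exact ⟨n, huv.trans hn⟩
  · rintro u ⟨m, hu⟩ v ⟨n, hv⟩
    exact List.prefix_or_prefix_of_prefix (hu.trans (hmono m _ (le_max_left m n)))
      (hv.trans (hmono n _ (le_max_right m n)))

theorem nil_mem_derivative {T : Set (List Bool)} (hT : PrefixClosed T)
    (h : ∀ b, (subtree b T).Infinite) : [] ∈ derivative T := by
  obtain ⟨P, hP⟩ := (hT.subtree false).exists_isInfiniteBranch (h false)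
  obtain ⟨Q, hQ⟩ := (hT.subtree true).exists_isInfiniteBranch (h true)
  obtain ⟨u, hu⟩ := hP.2.1.nonempty
  refine ⟨hT [] _ List.nil_prefix (hP.1 hu), _, _, hP.cons hT, hQ.cons hT, fun hPQ => ?_, .inl rfl,
    .inl rfl⟩
  have : false :: u ∈ insert [] ((true :: ·) '' Q) := hPQ ▸ .inr ⟨u, hu, rfl⟩
  simp at this

/-- If the `(n + 1)`-st derivative is empty, then the `n`-th derivative is finite below one of the
two children of the root. -/
theorem exists_finite_iterate_derivative_subtree {T : Set (List Bool)} (hT : PrefixClosed T) {n : ℕ}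
    (h : derivative^[n + 1] T = ∅) : ∃ b, (derivative^[n] (subtree b T)).Finite := by
  by_contra! hcon
  rw [Function.iterate_succ_apply'] at h
  have := nil_mem_derivative (hT.iterate_derivative n) fun b =>
    (hcon b : Set.Infinite _).mono (iterate_derivative_subtree_subset hT b n)
  rw [h] at this
  exact this

theorem finite_iterate_derivative_subtree {T : Set (List Bool)} (hT : PrefixClosed T) {n : ℕ}
    (h : (derivative^[n] T).Finite) (b : Bool) : (derivative^[n] (subtree b T)).Finite :=
  (h.preimage (List.cons_injective.injOn)).subset (iterate_derivative_subtree_subset hT b n)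

theorem ncard_iterate_derivative_subtree_lt {T : Set (List Bool)} (hT : PrefixClosed T) {n : ℕ}
    (h : (derivative^[n] T).Finite) (h0 : (derivative^[n] T).Nonempty) (b : Bool) :
    (derivative^[n] (subtree b T)).ncard < (derivative^[n] T).ncard := by
  obtain ⟨u, hu⟩ := h0
  have hnil : [] ∈ derivative^[n] T := hT.iterate_derivative n [] u List.nil_prefix hu
  rw [← Set.ncard_image_of_injective _ (List.cons_injective (a := b))]
  refine Set.ncard_lt_ncard ⟨?_, fun hcon => ?_⟩ h
  · rintro _ ⟨v, hv, rfl⟩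
    exact iterate_derivative_subtree_subset hT b n hv
  · obtain ⟨v, -, hv⟩ := hcon hnil
    simp at hv

end Derivative

/-! ### Types of trees -/

section Cell

universe w
variable {α : Type*} (𝒜 : TreeAutomaton α) (ℬ : TreeAutomaton (Fin 2 → Option α))

/-- The state reached on the convolution of two trees. -/
noncomputable def pairRun (s t : BinaryTree α) : ℬ.State := ℬ.run (convolution ![s, t])

theorem pairRun_eq {s t : BinaryTree α} (h : ¬ (s = .nil ∧ t = .nil)) :
    pairRun ℬ s t = ℬ.step ![label s [], label t []] (pairRun ℬ s.left t.left)
      (pairRun ℬ s.right t.right) := by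
  have hvec : ∀ {β : Type _} (f : BinaryTree α → β), (fun i => f (![s, t] i)) = ![f s, f t] :=
    fun f => by ext i; fin_cases i <;> rfl
  rw [pairRun, convolution, dif_neg (by simpa [Fin.forall_fin_two] using h), TreeAutomaton.run,
    hvec fun t => label t [], hvec BinaryTree.left, hvec BinaryTree.right]
  rfl

/-- All the information on a tree `t` that a bottom-up automaton can compute from the runs on `t`
and on the pairs `(∅, t)`, `(t, ∅)` and `(t, t)`. -/
abbrev Profile : Type := 𝒜.State × ℬ.State × ℬ.State × ℬ.State

/-- The profile of a tree. -/
noncomputable def profile (t : BinaryTree α) : Profile 𝒜 ℬ :=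
  (𝒜.run t, pairRun ℬ .nil t, pairRun ℬ t .nil, pairRun ℬ t t)

/-- The set of trees `t` with a given profile and given states on `(x, t)` and `(t, y)`. -/
def cell (x y : BinaryTree α) (p : Profile 𝒜 ℬ × ℬ.State × ℬ.State) : Set (BinaryTree α) :=
  {t | (profile 𝒜 ℬ t, pairRun ℬ x t, pairRun ℬ t y) = p}

/-- The relation on trees that is defined by acceptance with final states `S`. -/
def accRel (S : Set ℬ.State) (s t : BinaryTree α) : Prop := pairRun ℬ s t ∈ S

variable {𝒜 ℬ}

theorem pairRun_self_eq {x y t t' : BinaryTree α} {p : Profile 𝒜 ℬ × ℬ.State × ℬ.State}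
    (ht : t ∈ cell 𝒜 ℬ x y p) (ht' : t' ∈ cell 𝒜 ℬ x y p) : pairRun ℬ t t = pairRun ℬ t' t' := by
  have h : _ = _ := ht.trans ht'.symm
  simp only [profile, Prod.mk.injEq] at h
  exact h.1.2.2.2

/-- The cell of a tree is determined by the root label and the cells of its subtrees. -/
theorem node_mem_cell {x y : BinaryTree α} {a : α} {l l' r r' : BinaryTree α}
    {p pl pr : Profile 𝒜 ℬ × ℬ.State × ℬ.State}
    (hl : l ∈ cell 𝒜 ℬ x.left y.left pl) (hl' : l' ∈ cell 𝒜 ℬ x.left y.left pl)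
    (hr : r ∈ cell 𝒜 ℬ x.right y.right pr) (hr' : r' ∈ cell 𝒜 ℬ x.right y.right pr)
    (h : .node a l r ∈ cell 𝒜 ℬ x y p) : .node a l' r' ∈ cell 𝒜 ℬ x y p := by
  have h1 : _ = _ := hl'.trans hl.symm
  have h2 : _ = _ := hr'.trans hr.symm
  refine Eq.trans ?_ h
  simp only [profile, Prod.mk.injEq] at h1 h2 ⊢
  have hne : ∀ l r : BinaryTree α, BinaryTree.node a l r ≠ .nil := fun _ _ => nofun
  have hleft : ∀ l r : BinaryTree α, (BinaryTree.node a l r).left = l := fun _ _ => rfl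
  have hright : ∀ l r : BinaryTree α, (BinaryTree.node a l r).right = r := fun _ _ => rfl
  have hnl : (BinaryTree.nil : BinaryTree α).left = .nil := rfl
  have hnr : (BinaryTree.nil : BinaryTree α).right = .nil := rfl
  simp [pairRun_eq, hne, TreeAutomaton.run, hleft, hright, hnl, hnr, h1, h2, label,
    -BinaryTree.left, -BinaryTree.right]

/-- The trees `t` in a cell are linearly ordered by `accRel S`, this order has dimension at
most `β`, and the domains of the trees are contained in `T`. -/
structure GoodCell (x y : BinaryTree α) (T : Set (List Bool)) (S : Set ℬ.State) (β : Ordinal.{w})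
    (p : Profile 𝒜 ℬ × ℬ.State × ℬ.State) : Prop where
  lin : IsLin (accRel ℬ S) (cell 𝒜 ℬ x y p)
  dim : DimLE (accRel ℬ S) β (cell 𝒜 ℬ x y p)
  dom_subset : ∀ t ∈ cell 𝒜 ℬ x y p, dom t ⊆ T

instance : Finite (Profile 𝒜 ℬ) :=
  have := 𝒜.finite_state
  have := ℬ.finite_state
  inferInstanceAs (Finite (_ × _ × _ × _))

/-- Decomposition at the root: a cell consists of the empty tree and of finitely many boxes, whose
sides are cells of left and right subtrees. -/
theorem GoodCell.exists_dimLE_of_subtrees [Finite α] {x y : BinaryTree α} {T : Set (List Bool)}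
    {S : Set ℬ.State} {β δ : Ordinal.{w}} {p : Profile 𝒜 ℬ × ℬ.State × ℬ.State}
    (hp : GoodCell x y T S β p) (hδ : 0 < δ)
    (h : ∀ pl Sl pr Sr, GoodCell (𝒜 := 𝒜) x.left y.left (subtree false T) Sl β pl →
      GoodCell (𝒜 := 𝒜) x.right y.right (subtree true T) Sr β pr →
      ∃ c < δ, ∃ γl γr, NatSumLE γl γr c ∧ DimLE (accRel ℬ Sl) γl (cell 𝒜 ℬ x.left y.left pl) ∧
        DimLE (accRel ℬ Sr) γr (cell 𝒜 ℬ x.right y.right pr)) :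
    ∃ γ < δ, DimLE (accRel ℬ S) γ (cell 𝒜 ℬ x y p) := by
  have := ℬ.finite_state
  let C : Option (α × (Profile 𝒜 ℬ × ℬ.State × ℬ.State) × (Profile 𝒜 ℬ × ℬ.State × ℬ.State)) →
      Set (BinaryTree α) := fun i => i.elim {.nil} fun i => cell 𝒜 ℬ x y p ∩
    (fun z : BinaryTree α × BinaryTree α => .node i.1 z.1 z.2) ''
      (cell 𝒜 ℬ x.left y.left i.2.1 ×ˢ cell 𝒜 ℬ x.right y.right i.2.2)
  refine exists_dimLE_of_subset_iUnion hδ (s := C) (fun t ht => ?_) ?_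
  · rcases t with _ | ⟨a, l, r⟩
    · exact Set.mem_iUnion.2 ⟨none, rfl⟩
    · exact Set.mem_iUnion.2 ⟨some (a, _, _), ht, (l, r), ⟨rfl, rfl⟩, rfl⟩
  rintro (_ | ⟨a, pl, pr⟩)
  · exact ⟨0, hδ, dimLE_of_finite (Set.finite_singleton _) _⟩
  by_cases hne : (C (some (a, pl, pr))).Nonempty
  swap
  · exact ⟨0, hδ, dimLE_of_finite (Set.not_nonempty_iff_eq_empty.1 hne ▸ Set.finite_empty) _⟩
  obtain ⟨_, ht, ⟨l₀, r₀⟩, ⟨hl₀, hr₀⟩, rfl⟩ := hne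
  dsimp only at hl₀ hr₀
  have hmem : ∀ l ∈ cell 𝒜 ℬ x.left y.left pl, ∀ r ∈ cell 𝒜 ℬ x.right y.right pr,
      .node a l r ∈ cell 𝒜 ℬ x y p := fun l hl r hr => node_mem_cell hl₀ hl hr₀ hr ht
  let G : ℬ.State → ℬ.State → Prop := fun κ l => ℬ.step ![some a, some a] κ l ∈ S
  have hacc : ∀ l l' r r' : BinaryTree α, accRel ℬ S (.node a l r) (.node a l' r') ↔
      G (pairRun ℬ l l') (pairRun ℬ r r') := fun l l' r r' => by
    rw [accRel, pairRun_eq ℬ (by simp)]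
    rfl
  let Sl : Set ℬ.State := {κ | G κ (pairRun ℬ r₀ r₀)}
  let Sr : Set ℬ.State := {κ | G (pairRun ℬ l₀ l₀) κ}
  have hlinl : ∀ l l' : BinaryTree α, ∀ r ∈ cell 𝒜 ℬ x.right y.right pr,
      accRel ℬ S (.node a l r) (.node a l' r) ↔ accRel ℬ Sl l l' := fun l l' r hr => by
    rw [hacc, pairRun_self_eq hr hr₀]
    rfl
  have hlinr : ∀ l ∈ cell 𝒜 ℬ x.left y.left pl, ∀ r r' : BinaryTree α,
      accRel ℬ S (.node a l r) (.node a l r') ↔ accRel ℬ Sr r r' := fun l hl r r' => by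
    rw [hacc, pairRun_self_eq hl hl₀]
    rfl
  have hgl : GoodCell (𝒜 := 𝒜) x.left y.left (subtree false T) Sl β pl := by
    refine ⟨hp.lin.comap (fun l => .node a l r₀) ?_ (fun l hl => hmem l hl r₀ hr₀)
      fun l _ l' _ => (hlinl l l' r₀ hr₀).symm, hp.dim.comap (fun l => .node a l r₀) ?_
      (fun l hl => hmem l hl r₀ hr₀) fun l _ l' _ => (hlinl l l' r₀ hr₀).2, fun l hl u hu => ?_⟩
    · exact fun l _ l' _ hll' => (BinaryTree.node.inj hll').2.1
    · exact fun l _ l' _ hll' => (BinaryTree.node.inj hll').2.1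
    · exact hp.dom_subset _ (hmem l hl r₀ hr₀) (show label _ (false :: u) ≠ none from hu)
  have hgr : GoodCell (𝒜 := 𝒜) x.right y.right (subtree true T) Sr β pr := by
    refine ⟨hp.lin.comap (fun r => .node a l₀ r) ?_ (fun r hr => hmem l₀ hl₀ r hr)
      fun r _ r' _ => (hlinr l₀ hl₀ r r').symm, hp.dim.comap (fun r => .node a l₀ r) ?_
      (fun r hr => hmem l₀ hl₀ r hr) fun r _ r' _ => (hlinr l₀ hl₀ r r').2, fun r hr u hu => ?_⟩
    · exact fun l _ l' _ hll' => (BinaryTree.node.inj hll').2.2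
    · exact fun l _ l' _ hll' => (BinaryTree.node.inj hll').2.2
    · exact hp.dom_subset _ (hmem l₀ hl₀ r hr) (show label _ (true :: u) ≠ none from hu)
  obtain ⟨c, hc, γl, γr, hn, hdl, hdr⟩ := h pl Sl pr Sr hgl hgr
  have hbox : IsBox (fun z z' => accRel ℬ S (.node a z.1 z.2) (.node a z'.1 z'.2)) (accRel ℬ Sl)
      (accRel ℬ Sr) (pairRun ℬ) (pairRun ℬ) G (cell 𝒜 ℬ x.left y.left pl)
      (cell 𝒜 ℬ x.right y.right pr) := by
    refine ⟨hp.lin.comap (fun z => .node a z.1 z.2) ?_ (fun z hz => hmem z.1 hz.1 z.2 hz.2)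
      fun _ _ _ _ => Iff.rfl, hgl.lin, hgr.lin, fun l _ l' _ r hr => hlinl l l' r hr,
      fun l hl r _ r' _ => hlinr l hl r r', fun l _ l' _ r _ r' _ => hacc l l' r r'⟩
    exact fun z _ z' _ h => Prod.ext (BinaryTree.node.inj h).2.1 (BinaryTree.node.inj h).2.2
  refine ⟨c, hc, (hbox.dimLE hdl hdr hn).comap (fun t => (t.left, t.right)) ?_ ?_ ?_⟩
  · rintro _ ⟨-, z, -, rfl⟩ _ ⟨-, z', -, rfl⟩ hzz'
    obtain ⟨h1, h2⟩ := Prod.ext_iff.1 hzz'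
    exact congrArg₂ _ h1 h2
  · rintro _ ⟨-, z, hz, rfl⟩
    exact hz
  · rintro _ ⟨-, z, hz, rfl⟩ _ ⟨-, z', hz', rfl⟩ hzz'
    exact hzz'

end Cell

/-! ### Bounds by derivatives -/

section Bounds

universe u
open Ordinal
variable {α : Type*} {𝒜 : TreeAutomaton α} {ℬ : TreeAutomaton (Fin 2 → Option α)}

variable (𝒜 ℬ) in
/-- Cells without parameters whose trees have domains inside a set with finite `k`-th derivative
have dimension less than `ω ^ k`, provided that they have a dimension at all. -/
def LeafBound (k : ℕ) : Prop :=
  ∀ (T : Set (List Bool)) (S : Set ℬ.State) (β : Ordinal.{u})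
    (p : Profile 𝒜 ℬ × ℬ.State × ℬ.State), PrefixClosed T → (derivative^[k] T).Finite →
    GoodCell (𝒜 := 𝒜) .nil .nil T S β p →
    ∃ γ < (ω : Ordinal.{u}) ^ (k : Ordinal), DimLE (accRel ℬ S) γ (cell 𝒜 ℬ .nil .nil p)

theorem numNodes_left_add_right_lt {x y : BinaryTree α} (h : ¬ (x = .nil ∧ y = .nil)) :
    x.left.numNodes + y.left.numNodes < x.numNodes + y.numNodes ∧
      x.right.numNodes + y.right.numNodes < x.numNodes + y.numNodes := by
  rcases x with _ | ⟨a, l, r⟩ <;> rcases y with _ | ⟨b, l', r'⟩ <;>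
    simp_all [BinaryTree.left, BinaryTree.right]
  omega

/-- The bound for cells without parameters implies the one for all cells. -/
theorem LeafBound.exists_dimLE [Finite α] {k : ℕ} (hk : LeafBound.{u} 𝒜 ℬ k) (n : ℕ)
    {x y : BinaryTree α} (hn : x.numNodes + y.numNodes ≤ n) {T : Set (List Bool)}
    {S : Set ℬ.State} {β : Ordinal.{u}} {p : Profile 𝒜 ℬ × ℬ.State × ℬ.State}
    (hT : PrefixClosed T) (hfin : (derivative^[k] T).Finite)
    (hp : GoodCell (𝒜 := 𝒜) x y T S β p) :
    ∃ γ < (ω : Ordinal.{u}) ^ (k : Ordinal), DimLE (accRel ℬ S) γ (cell 𝒜 ℬ x y p) := by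
  induction n generalizing x y T S p with
  | zero =>
    rcases x with _ | ⟨a, l, r⟩ <;> rcases y with _ | ⟨b, l', r'⟩ <;> simp at hn
    exact hk T S β p hT hfin hp
  | succ n ih =>
    by_cases h : x = .nil ∧ y = .nil
    · obtain ⟨rfl, rfl⟩ := h
      exact hk T S β p hT hfin hp
    have hlt := numNodes_left_add_right_lt h
    refine hp.exists_dimLE_of_subtrees (opow_pos _ omega0_pos) fun pl Sl pr Sr hl hr => ?_
    obtain ⟨γl, hγl, hdl⟩ := ih (by omega) (hT.subtree _)
      (finite_iterate_derivative_subtree hT hfin _) hl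
    obtain ⟨γr, hγr, hdr⟩ := ih (by omega) (hT.subtree _)
      (finite_iterate_derivative_subtree hT hfin _) hr
    obtain ⟨c, hc, hs⟩ := exists_natSumLE_lt_opow k γl hγl γr hγr
    exact ⟨c, hc, γl, γr, hs, hdl, hdr⟩

/-- There are only finitely many pairs of a cell without parameters and an order on it, so the
dimensions that are less than `ω ^ (k + 1)` have a common bound. -/
theorem exists_leaf_bound (𝒜 : TreeAutomaton α) (ℬ : TreeAutomaton (Fin 2 → Option α)) (k : ℕ) :
    ∃ J : ℕ, 1 ≤ J ∧ ∀ (S : Set ℬ.State) (p : Profile 𝒜 ℬ × ℬ.State × ℬ.State),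
      ∀ γ < (ω : Ordinal.{u}) ^ ((k + 1 : ℕ) : Ordinal),
      DimLE (accRel ℬ S) γ (cell 𝒜 ℬ .nil .nil p) →
      ∃ γ < (ω : Ordinal.{u}) ^ (k : Ordinal) * J,
        DimLE (accRel ℬ S) γ (cell 𝒜 ℬ .nil .nil p) := by
  have := ℬ.finite_state
  have h : ∀ q : Set ℬ.State × Profile 𝒜 ℬ × ℬ.State × ℬ.State, ∃ j : ℕ,
      ∀ γ < (ω : Ordinal.{u}) ^ ((k + 1 : ℕ) : Ordinal),
      DimLE (accRel ℬ q.1) γ (cell 𝒜 ℬ .nil .nil q.2) →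
      ∃ γ < (ω : Ordinal.{u}) ^ (k : Ordinal) * j,
        DimLE (accRel ℬ q.1) γ (cell 𝒜 ℬ .nil .nil q.2) := fun q => by
    by_cases hq : ∃ γ < (ω : Ordinal.{u}) ^ ((k + 1 : ℕ) : Ordinal),
        DimLE (accRel ℬ q.1) γ (cell 𝒜 ℬ .nil .nil q.2)
    · obtain ⟨γ, hγ, hd⟩ := hq
      obtain ⟨j, hj⟩ := exists_lt_opow_mul_natCast hγ
      exact ⟨j, fun _ _ _ => ⟨γ, hj, hd⟩⟩
    · exact ⟨0, fun γ hγ hd => absurd ⟨γ, hγ, hd⟩ hq⟩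
  choose j hj using h
  cases nonempty_fintype (Set ℬ.State × Profile 𝒜 ℬ × ℬ.State × ℬ.State)
  refine ⟨Finset.univ.sup j + 1, by omega, fun S p γ hγ hd => ?_⟩
  obtain ⟨γ', hγ', hd'⟩ := hj (S, p) γ hγ hd
  refine ⟨γ', hγ'.trans_le ?_, hd'⟩
  gcongr
  exact (Finset.le_sup (f := j) (Finset.mem_univ (S, p))).trans (Nat.le_succ _)

/-- Uniform bound for all cells with domains inside a set `T` with finite `(k + 1)`-st derivative.
Descending from the root, both subtrees can contribute multiples of `ω ^ k` to the dimension only at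
the nodes in the `(k + 1)`-st derivative; this may double the bound at each of these nodes.
At all other nodes, one of the two subtrees has a finite `k`-th derivative, so that it contributes
less than `ω ^ k`. -/
theorem LeafBound.exists_dimLE_lt_mul [Finite α] {k : ℕ} (hk : LeafBound.{u} 𝒜 ℬ k) {J : ℕ}
    (hJ1 : 1 ≤ J) (hJ : ∀ (S : Set ℬ.State) (p : Profile 𝒜 ℬ × ℬ.State × ℬ.State),
      ∀ γ < (ω : Ordinal.{u}) ^ ((k + 1 : ℕ) : Ordinal),
      DimLE (accRel ℬ S) γ (cell 𝒜 ℬ .nil .nil p) →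
      ∃ γ < (ω : Ordinal.{u}) ^ (k : Ordinal) * J,
        DimLE (accRel ℬ S) γ (cell 𝒜 ℬ .nil .nil p))
    {β : Ordinal.{u}} (hβ : β < ω ^ ((k + 1 : ℕ) : Ordinal)) (n N : ℕ)
    {x y : BinaryTree α} (hn : x.numNodes + y.numNodes ≤ n) {T : Set (List Bool)}
    {S : Set ℬ.State} {p : Profile 𝒜 ℬ × ℬ.State × ℬ.State}
    (hT : PrefixClosed T) (hfin : (derivative^[k + 1] T).Finite)
    (hN : (derivative^[k + 1] T).ncard ≤ N) (hp : GoodCell (𝒜 := 𝒜) x y T S β p) :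
    ∃ γ < (ω : Ordinal.{u}) ^ (k : Ordinal) * ((J * 2 ^ N : ℕ) : Ordinal),
      DimLE (accRel ℬ S) γ (cell 𝒜 ℬ x y p) := by
  have hpos : ∀ N, 0 < (ω : Ordinal.{u}) ^ (k : Ordinal) * ((J * 2 ^ N : ℕ) : Ordinal) := fun N =>
    opow_mul_natCast_pos k (Nat.mul_pos hJ1 (Nat.two_pow_pos N))
  have hmono : ∀ {m m' : ℕ}, m ≤ m' →
      (ω : Ordinal.{u}) ^ (k : Ordinal) * m ≤ ω ^ (k : Ordinal) * m' := fun h => by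
    gcongr
  have hleaf : ∀ N {T S p}, GoodCell (𝒜 := 𝒜) .nil .nil T S β p →
      ∃ γ < (ω : Ordinal.{u}) ^ (k : Ordinal) * ((J * 2 ^ N : ℕ) : Ordinal),
      DimLE (accRel ℬ S) γ (cell 𝒜 ℬ .nil .nil p) := @fun N T S p hp => by
    obtain ⟨γ, hγ, hd⟩ := hJ S p β hβ hp.dim
    exact ⟨γ, hγ.trans_le (hmono (Nat.le_mul_of_pos_right _ (Nat.two_pow_pos N))), hd⟩
  have hη := exists_natSumLE_lt_opow.{u} k
  induction n generalizing N x y T S p with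
  | zero =>
    rcases x with _ | ⟨a, l, r⟩ <;> rcases y with _ | ⟨b, l', r'⟩ <;> simp at hn
    exact hleaf N hp
  | succ n ih =>
    by_cases h : x = .nil ∧ y = .nil
    · obtain ⟨rfl, rfl⟩ := h
      exact hleaf N hp
    have hlt := numNodes_left_add_right_lt h
    have hfin' := finite_iterate_derivative_subtree hT hfin
    rcases Set.eq_empty_or_nonempty (derivative^[k + 1] T) with h0 | h0
    · have h0' : ∀ b, (derivative^[k + 1] (subtree b T)).ncard ≤ 0 := fun b => by
        have hsub := iterate_derivative_subtree_subset hT b (k + 1)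
        rw [h0] at hsub
        rw [Set.eq_empty_of_subset_empty (hsub.trans (by simp [subtree])), Set.ncard_empty]
      suffices ∃ γ < (ω : Ordinal.{u}) ^ (k : Ordinal) * ((J * 2 ^ 0 : ℕ) : Ordinal),
          DimLE (accRel ℬ S) γ (cell 𝒜 ℬ x y p) by
        obtain ⟨γ, hγ, hd⟩ := this
        exact ⟨γ, hγ.trans_le (hmono (by gcongr <;> omega)), hd⟩
      refine hp.exists_dimLE_of_subtrees (hpos 0)
        fun pl Sl pr Sr hl hr => ?_
      obtain ⟨_ | _, hb⟩ := exists_finite_iterate_derivative_subtree hT h0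
      · obtain ⟨γl, hγl, hdl⟩ := hk.exists_dimLE n (by omega) (hT.subtree _) hb hl
        obtain ⟨γr, hγr, hdr⟩ := ih 0 (by omega) (hT.subtree _) (hfin' _) (h0' _) hr
        rw [← mul_one (ω ^ _), ← Nat.cast_one] at hγl
        obtain ⟨c, hc, hs⟩ := exists_natSumLE_lt_mul hη hγl hγr (p := J * 2 ^ 0) (by omega)
        exact ⟨c, hc, γl, γr, hs, hdl, hdr⟩
      · obtain ⟨γl, hγl, hdl⟩ := ih 0 (by omega) (hT.subtree _) (hfin' _) (h0' _) hl
        obtain ⟨γr, hγr, hdr⟩ := hk.exists_dimLE n (by omega) (hT.subtree _) hb hr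
        rw [← mul_one (ω ^ _), ← Nat.cast_one] at hγr
        obtain ⟨c, hc, hs⟩ := exists_natSumLE_lt_mul hη hγl hγr (p := J * 2 ^ 0) (by omega)
        exact ⟨c, hc, γl, γr, hs, hdl, hdr⟩
    · have hlt' := ncard_iterate_derivative_subtree_lt hT hfin h0
      rcases N with _ | N
      · exact absurd (hlt' true) (by omega)
      refine hp.exists_dimLE_of_subtrees (hpos (N + 1))
        fun pl Sl pr Sr hl hr => ?_
      have h1 := hlt' false
      have h2 := hlt' true
      obtain ⟨γl, hγl, hdl⟩ := ih N (by omega) (hT.subtree _) (hfin' _) (by omega) hl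
      obtain ⟨γr, hγr, hdr⟩ := ih N (by omega) (hT.subtree _) (hfin' _) (by omega) hr
      obtain ⟨c, hc, hs⟩ := exists_natSumLE_lt_mul hη hγl hγr (p := J * 2 ^ (N + 1))
        (by rw [pow_succ, ← mul_assoc]; omega)
      exact ⟨c, hc, γl, γr, hs, hdl, hdr⟩

end Bounds

/-! ### Induction on the rank -/

section Rank

universe u
open Ordinal
variable {α : Type*} {𝒜 : TreeAutomaton α} {ℬ : TreeAutomaton (Fin 2 → Option α)}

theorem finite_setOf_dom_subset [Finite α] {T : Set (List Bool)} (hT : T.Finite) :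
    {t : BinaryTree α | dom t ⊆ T}.Finite := by
  have : Finite T := hT
  refine Set.Finite.of_finite_image (f := fun t (u : T) => label t u) (Set.toFinite _) ?_
  intro s hs t ht hst
  refine label_injective (funext fun u => ?_)
  by_cases hu : u ∈ T
  · exact congrFun hst ⟨u, hu⟩
  · have hs' : label s u = none := by_contra fun h => hu (hs h)
    have ht' : label t u = none := by_contra fun h => hu (ht h)
    rw [hs', ht']

/-- Trees over a finite alphabet form a countable set, so that any universe holds a copy of it. -/
instance [Finite α] : Small.{u} (BinaryTree α) := by
  obtain ⟨n, ⟨e⟩⟩ := Finite.exists_equiv_fin α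
  refine small_of_injective (f := BinaryTree.map e) fun s => ?_
  induction s with
  | nil => rintro (_ | ⟨b, l', r'⟩) h <;> simp_all [BinaryTree.map]
  | node a l r ihl ihr =>
    rintro (_ | ⟨b, l', r'⟩) h
    · simp [BinaryTree.map] at h
    · simp only [BinaryTree.map, BinaryTree.node.injEq, EmbeddingLike.apply_eq_iff_eq] at h
      rw [h.1, ihl h.2.1, ihr h.2.2]

theorem IsLin.exists_linearOrder {X : Type*} {r : X → X → Prop} {s : Set X} (h : IsLin r s)
    [Small.{u} s] : ∃ (B : Type u) (_ : LinearOrder B) (μ : B → X), Function.Injective μ ∧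
      Set.range μ = s ∧ ∀ x y, x ≤ y ↔ r (μ x) (μ y) := by
  classical
  let μ : Shrink.{u} s → X := fun b => ((equivShrink s).symm b : s)
  have hμ : ∀ b, μ b ∈ s := fun b => ((equivShrink s).symm b).2
  have hinj : Function.Injective μ := Subtype.val_injective.comp (equivShrink s).symm.injective
  refine ⟨Shrink.{u} s,
    { le := fun x y => r (μ x) (μ y)
      le_refl := fun x => h.refl _ (hμ x)
      le_trans := fun x y z => h.trans _ (hμ x) _ (hμ y) _ (hμ z)
      le_antisymm := fun x y h1 h2 => hinj (h.antisymm _ (hμ x) _ (hμ y) h1 h2)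
      le_total := fun x y => h.total _ (hμ x) _ (hμ y)
      toDecidableLE := Classical.decRel _ }, μ, hinj, ?_, fun x y => Iff.rfl⟩
  ext x
  refine ⟨?_, fun hx => ⟨equivShrink s ⟨x, hx⟩, by simp [μ]⟩⟩
  rintro ⟨b, rfl⟩
  exact hμ b

theorem opow_mul_natCast_add_one_lt (k m : ℕ) :
    (ω : Ordinal.{u}) ^ (k : Ordinal) * m + 1 < ω ^ ((k + 1 : ℕ) : Ordinal) := by
  have h : Order.IsSuccLimit ((ω : Ordinal.{u}) ^ ((k + 1 : ℕ) : Ordinal)) :=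
    isSuccLimit_opow_left isSuccLimit_omega0 (by simp)
  exact h.add_one_lt (opow_mul_natCast_lt k m)

/-- In a linear order of trees that is given by `accRel S`, closed intervals are finite unions of
cells, so they inherit the uniform bound for cells. -/
theorem LeafBound.exists_dimLE_Icc [Finite α] {k : ℕ} (hk : LeafBound.{u} 𝒜 ℬ k)
    {T : Set (List Bool)} (hT : PrefixClosed T) (hfin : (derivative^[k + 1] T).Finite) :
    ∃ M : ℕ, ∀ (B : Type u) [LinearOrder B] (μ : B → BinaryTree α) (S : Set ℬ.State)
      (F : Set (Profile 𝒜 ℬ)), Function.Injective μ → (∀ x y, x ≤ y ↔ accRel ℬ S (μ x) (μ y)) →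
      Set.range μ = {t | profile 𝒜 ℬ t ∈ F} → (∀ x, dom (μ x) ⊆ T) →
      ∀ x y : B, ∀ β < (ω : Ordinal.{u}) ^ ((k + 1 : ℕ) : Ordinal),
        DimLE (· ≤ ·) β (Set.Icc x y) → ∃ γ < (ω : Ordinal.{u}) ^ (k : Ordinal) * M,
          DimLE (· ≤ ·) γ (Set.Icc x y) := by
  obtain ⟨J, hJ1, hJ⟩ := exists_leaf_bound 𝒜 ℬ k
  refine ⟨J * 2 ^ (derivative^[k + 1] T).ncard, ?_⟩
  intro B _ μ S F hinj hle hrange hdom x y β hβ hd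
  have := ℬ.finite_state
  have hpos : 0 < (ω : Ordinal.{u}) ^ (k : Ordinal) *
      ((J * 2 ^ (derivative^[k + 1] T).ncard : ℕ) : Ordinal) :=
    opow_mul_natCast_pos k (Nat.mul_pos hJ1 (Nat.two_pow_pos _))
  refine exists_dimLE_of_subset_iUnion hpos
    (ι := {p : Profile 𝒜 ℬ × ℬ.State × ℬ.State // p.1 ∈ F ∧ p.2.1 ∈ S ∧ p.2.2 ∈ S})
    (s := fun p => μ ⁻¹' cell 𝒜 ℬ (μ x) (μ y) p) (fun z hz => ?_) fun ⟨p, hpF, hpx, hpy⟩ => ?_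
  · have hzF : profile 𝒜 ℬ (μ z) ∈ F := by
      have := Set.mem_range_self (f := μ) z
      rwa [hrange] at this
    exact Set.mem_iUnion.2 ⟨⟨(profile 𝒜 ℬ (μ z), pairRun ℬ (μ x) (μ z), pairRun ℬ (μ z) (μ y)),
      hzF, (hle _ _).1 hz.1, (hle _ _).1 hz.2⟩, rfl⟩
  have hcell : ∀ t ∈ cell 𝒜 ℬ (μ x) (μ y) p, ∃ z ∈ Set.Icc x y, μ z = t := by
    intro t ht
    have hp : _ = p := ht
    subst hp
    have htF : t ∈ Set.range μ := hrange ▸ hpF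
    obtain ⟨z, rfl⟩ := htF
    exact ⟨z, ⟨(hle _ _).2 hpx, (hle _ _).2 hpy⟩, rfl⟩
  have : Nonempty B := ⟨x⟩
  choose! g hg hμg using hcell
  have hgood : GoodCell (𝒜 := 𝒜) (μ x) (μ y) T S β p := by
    have hginj : Set.InjOn g (cell 𝒜 ℬ (μ x) (μ y) p) := fun t ht t' ht' htt' => by
      rw [← hμg t ht, ← hμg t' ht', htt']
    have hgle : ∀ t ∈ cell 𝒜 ℬ (μ x) (μ y) p, ∀ t' ∈ cell 𝒜 ℬ (μ x) (μ y) p,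
        accRel ℬ S t t' ↔ g t ≤ g t' := fun t ht t' ht' => by
      rw [hle, hμg t ht, hμg t' ht']
    refine ⟨?_, hd.comap g hginj hg fun t ht t' ht' => (hgle t ht t' ht').1,
      fun t ht => hμg t ht ▸ hdom _⟩
    have hB : IsLin (· ≤ ·) (Set.univ : Set B) := ⟨fun _ _ => le_rfl,
      fun _ _ _ _ => le_antisymm, fun _ _ _ _ _ _ => le_trans, fun _ _ _ _ => le_total _ _⟩
    exact hB.comap g hginj (fun _ _ => Set.mem_univ _) hgle
  obtain ⟨γ, hγ, hd'⟩ := hk.exists_dimLE_lt_mul hJ1 hJ hβ _ _ le_rfl hT hfin le_rfl hgood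
  exact ⟨γ, hγ, hd'.comap μ hinj.injOn (fun z hz => hz) fun z _ z' _ => (hle z z').1⟩

/-- The induction on `k`. Given the bound for `k`, all intervals of a cell whose dimension is less
than `ω ^ (k + 1)` have dimension less than some fixed `ω ^ k * M`. By this gap the iterated
condensations of the cell are constant from `ω ^ k * M` on. If the cell has a dimension at all,
some iterated condensation has a single class, hence so does this one. -/
theorem leafBound (𝒜 : TreeAutomaton α) (ℬ : TreeAutomaton (Fin 2 → Option α)) [Finite α] (k : ℕ) :
    LeafBound.{u} 𝒜 ℬ k := by
  induction k with
  | zero =>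
    intro T S β p hT hfin hp
    exact ⟨0, by simp, dimLE_of_finite
      ((finite_setOf_dom_subset hfin).subset fun t ht => hp.dom_subset t ht) _⟩
  | succ k ih =>
    intro T S β p hT hfin hp
    obtain ⟨M, hM⟩ := ih.exists_dimLE_Icc hT hfin
    have hlt := opow_mul_natCast_add_one_lt.{u} k M
    rcases Set.eq_empty_or_nonempty (cell 𝒜 ℬ .nil .nil p) with h0 | ⟨t₀, ht₀⟩
    · exact ⟨0, opow_pos _ omega0_pos, dimLE_of_finite (h0 ▸ Set.finite_empty) _⟩
    have hcell : cell 𝒜 ℬ .nil .nil p = {t | profile 𝒜 ℬ t ∈ ({p.1} : Set _)} := by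
      have h0 : _ = p := ht₀
      subst h0
      ext t
      simp +contextual [cell, profile]
    obtain ⟨B, _, μ, hinj, hrange, hle⟩ := hp.lin.exists_linearOrder.{u}
    have hmem : ∀ b, μ b ∈ cell 𝒜 ℬ .nil .nil p := fun b => hrange ▸ Set.mem_range_self b
    have hd := dimLE_univ_of_dimLE_gap hlt
      (hM B μ S {p.1} hinj hle (hrange.trans hcell) fun b => hp.dom_subset _ (hmem b))
      (hp.dim.comap μ hinj.injOn (fun b _ => hmem b) fun x _ y _ => (hle x y).1)
    have hsurj : ∀ t ∈ cell 𝒜 ℬ .nil .nil p, ∃ b, μ b = t := fun t ht => by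
      rwa [← hrange] at ht
    obtain ⟨b₀, -⟩ := hsurj t₀ ht₀
    have : Nonempty B := ⟨b₀⟩
    choose! g hg using hsurj
    refine ⟨_, hlt, hd.comap g (fun t ht t' ht' h => ?_) (fun _ _ => Set.mem_univ _)
      fun t ht t' ht' h => ?_⟩
    · rw [← hg t ht, ← hg t' ht', h]
    · rwa [hle, hg t ht, hg t' ht']

end Rank

/-! ### Presentations -/

theorem convolution_injective {α : Type*} {n : ℕ} :
    Function.Injective (convolution : (Fin n → BinaryTree α) → BinaryTree (Fin n → Option α)) := by
  intro s t h
  refine funext fun i => label_injective (funext fun u => ?_)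
  have hu := congrArg (fun z => label z u) h
  simp only [label_convolution] at hu
  split_ifs at hu with h1 h2
  · rw [h1, h2]
  · exact congrFun (Option.some.inj hu) i

theorem prefixClosed_dom {α : Type*} (t : BinaryTree α) : PrefixClosed (dom t) :=
  fun u v huv hv => ((exists_label_iff (label t)).1 ⟨t, rfl⟩).2 u v huv hv

theorem prefixClosed_domainTree {α : Type*} (K : Set (BinaryTree α)) :
    PrefixClosed (domainTree K) := by
  intro u v huv hv
  obtain ⟨t, ht, hv⟩ := Set.mem_iUnion₂.1 hv
  exact Set.mem_iUnion₂.2 ⟨t, ht, prefixClosed_dom t u v huv hv⟩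

open FirstOrder.Language in
/-- A presentation of a linear order is an order isomorphism onto the language of the first
automaton, ordered by acceptance of the second one. -/
theorem Presentation.Presents.exists_accRel {A : Type*} [LinearOrder A]
    [FirstOrder.Language.order.Structure A] [FirstOrder.Language.order.OrderedStructure A]
    {α : Type*} {P : Presentation α FirstOrder.Language.order} (hP : P.Presents A) :
    ∃ μ : A → BinaryTree α, Function.Injective μ ∧ Set.range μ = P.univ.language ∧
      ∀ x y, x ≤ y ↔ accRel (P.rel (leSymb : FirstOrder.Language.order.Relations 2))
        (P.rel leSymb).accept (μ x) (μ y) := by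
  obtain ⟨μ, hμ, hrel⟩ := hP
  have hinj : Function.Injective μ := Set.injOn_univ.1 hμ.injOn
  refine ⟨μ, hinj, by rw [← Set.image_univ, hμ.image_eq], fun x y => ?_⟩
  have h1 : accRel (P.rel (leSymb : FirstOrder.Language.order.Relations 2))
      (P.rel leSymb).accept (μ x) (μ y) ↔ convolution ![μ x, μ y] ∈
        (P.rel (leSymb : FirstOrder.Language.order.Relations 2)).language := Iff.rfl
  have h2 : ![μ x, μ y] = μ ∘ ![x, y] := by ext i; fin_cases i <;> rfl
  have hrec := hrel 2 leSymb
  rw [TreeAutomaton.Recognises] at hrec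
  rw [h1, hrec, convolution_injective.mem_set_image, h2,
    Function.Injective.mem_set_image (f := fun z : Fin 2 → A => μ ∘ z) hinj.comp_left]
  exact (relMap_leSymb ![x, y]).symm

end TreeAut

theorem mainTheorem2 {A : Type*} [LinearOrder A]
    [FirstOrder.Language.order.Structure A] [FirstOrder.Language.order.OrderedStructure A]
    {α : Type*} [Finite α] (P : TreeAut.Presentation α FirstOrder.Language.order)
    (hP : P.Presents A) (hfree : P.TbinFree)
    (k : ℕ) (hk : 1 ≤ k) (hrank : P.HasRank k) :
    TreeAut.fcRank A < Ordinal.omega0 ^ (k : Ordinal) := by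
  obtain ⟨k, rfl⟩ := Nat.exists_eq_add_of_le' hk
  obtain ⟨μ, hinj, hrange, hle⟩ := hP.exists_accRel
  obtain ⟨M, hM⟩ := (TreeAut.leafBound P.univ
    (P.rel FirstOrder.Language.leSymb) k).exists_dimLE_Icc
    (TreeAut.prefixClosed_domainTree P.univ.language) hrank.1
  have hgap := hM A μ _ {q | q.1 ∈ P.univ.accept} hinj hle hrange fun x u hu =>
    Set.mem_iUnion₂.2 ⟨μ x, hrange ▸ Set.mem_range_self x, hu⟩
  have hδ := TreeAut.opow_mul_natCast_add_one_lt k M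
  have hrank : TreeAut.fcRank A ≤ Ordinal.omega0 ^ (k : Ordinal) * M :=
    csInf_le' (s := {γ | ∀ β, γ ≤ β → TreeAut.fcRel A β = TreeAut.fcRel A γ})
      fun β hβ => TreeAut.fcRel_eq_of_dimLE_gap hδ hgap hβ
  exact hrank.trans_lt (TreeAut.opow_mul_natCast_lt k M)
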